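/- Let $\Theta$ be a (symmetric) positive definite $n\times n$ matrix and let $G=(G_s)_{s\in\mathbb R}$ be a centred $n$-dimensional process with stationary increments, $G_0=0$, almost surely continuous paths and $\sup_{s\in[0,1]}\mathbb E[(G^{(i)}_s)^2]<\infty$ for all $i$. Let $U$ be the solution of $dU_s=-\Theta U_s\,ds+dG_s$, $s\in\mathbb R$, with $U_0=\int_{-\infty}^0 e^{\Theta s}dG_s$ (the integral being understood pathwise via integration by parts, i.e. $U_0=G_0-\Theta\lim_{s\to-\infty}\int_s^0e^{\Theta u}G_u\,du$ almost surely). Put $\gamma(s)=\mathbb E(U_sU_0^\top)$ and, for a fixed $t\ge 0$, $$B=\int_0^t(\gamma(s)-\gamma(s)^\top)\,ds,\qquad C=\int_0^t\int_0^t\gamma(s-u)\,du\,ds,\qquad D=\mathrm{cov}(G_t)-\mathrm{cov}(U_t-U_0).$$ For $T\in\mathbb R$ (with $T\to\infty$) let $\hat\gamma_T(s)$, $s\in[0,t]$, be random $n\times n$ matrices (arbitrary estimators of $\gamma(s)$) such that $\hat\gamma_T-\gamma$ has almost surely continuous paths on $[0,t]$, and put $\hat\gamma_T(-s)=\hat\gamma_T(s)^\top$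 for $0<s\le t$. Let $\hat B_T$, $\hat C_T$ be obtained from $B$, $C$ by replacing $\gamma$ by $\hat\gamma_T$, let $\hat D_T=\mathrm{cov}(G_t)-(2\hat\gamma_T(0)-\hat\gamma_T(t)-\hat\gamma_T(t)^\top)$, and write $\Delta_TB=\hat B_T-B$, $\Delta_TC=\hat C_T-C$, $\Delta_TD=\hat D_T-D$. Let $\hat\Theta_T$ be the positive semidefinite solution of $$\hat B_T^\top\hat\Theta_T+\hat\Theta_T\hat B_T-\hat\Theta_T\hat C_T\hat\Theta_T+\hat D_T=0$$ whenever there is exactly one such solution, and $\hat\Theta_T=0$ otherwise. Let $\mathrm{vec}$ denote column-stacking vectorization. Let $X=(X_s)_{s\in[0,t]}$ be an $n^2$-dimensional process with almost surely continuous paths, let $l$ be a rate function, i.e. $l(T)\to\infty$ as $T\to\infty$, and suppose that, as $T\to\infty$, $l(T)\,\mathrm{vec}(\hat\gamma_T-\gamma)$ converges in law to $X$ in the space of continuous functions on $[0,t]$ with the uniform topology. Let $\tilde X_s$ be the permutation of the entries of $X_s$ that takes $\mathrm{vec}(A)$ to $\mathrm{vec}(A^\top)$. Then: (1) As $T\to\infty$,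 $$l(T)\,\mathrm{vec}(\Delta_TC,\Delta_TB,\Delta_TD)\ \xrightarrow{\ \text{law}\ }\ L_1(X):=\begin{bmatrix}\int_0^t(t-s)(X_s+\tilde X_s)\,ds\\ \int_0^t(X_s-\tilde X_s)\,ds\\ X_t+\tilde X_t-2X_0\end{bmatrix}.$$ (2) If $C$ and $D$ are positive definite and, for every $T$, the matrix $\hat\gamma_T(0)$ is almost surely symmetric, then with $\Phi=B-C\Theta$ the Kronecker sum $\Phi^\top\oplus\Phi^\top=I\otimes\Phi^\top+\Phi^\top\otimes I$ is invertible and $$l(T)\,\mathrm{vec}(\hat\Theta_T-\Theta)\ \xrightarrow{\ \text{law}\ }\ L_2(L_1(X)),$$ where $L_2:\mathbb R^{3n^2}\to\mathbb R^{n^2}$ is the linear map $$L_2(c,b,d)=(\Phi^\top\oplus\Phi^\top)^{-1}\big((\Theta\otimes\Theta)c-d-(\Theta\otimes I)\tilde b-(I\otimes\Theta)b\big),$$ $\tilde b$ being the permutation of $b$ that takes $\mathrm{vec}(A)$ to $\mathrm{vec}(A^\top)$. The map $L_2$ depends only on $\Theta$, $t$ and the cross-covariance $(u,v)\mapsto\mathbb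 E(G_uG_v^\top)$ of $G$: it is the same for any two such systems with the same $\Theta$, $t$ and cross-covariance. -/

import Mathlib

open MeasureTheory ProbabilityTheory Filter Topology
open scoped Matrix Kronecker ENNReal

universe u v

noncomputable section

namespace Langevin

/-! ### The model -/

/-- `G` has stationary increments: for all times `τ 0, …, τ (m-1)` the law of the vector of
increments `G (τ i + h) - G h` does not depend on the shift `h`. -/
def StationaryIncrements {n : ℕ} {Ω : Type u} [MeasurableSpace Ω] (P : Measure Ω)
    (G : ℝ → Ω → Fin n → ℝ) : Prop :=
  ∀ (h : ℝ) (m : ℕ) (τ : Fin m → ℝ),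
    IdentDistrib (fun ω (i : Fin m) => G (τ i + h) ω - G h ω)
      (fun ω (i : Fin m) => G (τ i) ω - G 0 ω) P P

/-- `v = ∫_{-∞}^0 e^{Θ u} dg_u`, the integral being defined through integration by parts, that is
`v = g_0 - Θ lim_{s → -∞} ∫_s^0 e^{Θ u} g_u du`, where the limit is required to exist. -/
def HasImproperIntegral {n : ℕ} (Θ : Matrix (Fin n) (Fin n) ℝ) (g : ℝ → Fin n → ℝ)
    (v : Fin n → ℝ) : Prop :=
  ∃ I : Fin n → ℝ,
    Tendsto (fun s : ℝ => ∫ u in s..0, NormedSpace.exp (u • Θ) *ᵥ g u) atBot (𝓝 I) ∧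
      v = g 0 - Θ *ᵥ I

/-- The standing assumptions: `Θ` is a positive definite matrix, `G` is a centred `n`-dimensional
process with stationary increments, `G_0 = 0`, almost surely continuous paths and
`sup_{s ∈ [0,1]} E (G_s^{(i)})² < ∞`; and `U` is the continuous solution of the Langevin equation
`dU_t = -Θ U_t dt + dG_t`, `t ∈ ℝ`, with initial value `U_0 = ∫_{-∞}^0 e^{Θ s} dG_s`. -/
structure LangevinSystem {n : ℕ} {Ω : Type u} [MeasurableSpace Ω] (P : Measure Ω)
    (Θ : Matrix (Fin n) (Fin n) ℝ) (G U : ℝ → Ω → Fin n → ℝ) : Prop where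
  posDef : Θ.PosDef
  aemeasurable : ∀ s, AEMeasurable (G s) P
  zero : ∀ᵐ ω ∂P, G 0 ω = 0
  continuous : ∀ᵐ ω ∂P, Continuous fun s => G s ω
  stationaryIncrements : StationaryIncrements P G
  secondMoment : ∀ i, (⨆ s ∈ Set.Icc (0 : ℝ) 1, ∫⁻ ω, ‖G s ω i‖ₑ ^ 2 ∂P) < ∞
  centred : ∀ s i, ∫ ω, G s ω i ∂P = 0
  solution_continuous : ∀ᵐ ω ∂P, Continuous fun s => U s ω
  solution : ∀ᵐ ω ∂P, ∀ a b : ℝ, a ≤ b →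
    U b ω - U a ω = -(Θ *ᵥ ∫ s in a..b, U s ω) + (G b ω - G a ω)
  initial : ∀ᵐ ω ∂P, HasImproperIntegral Θ (fun s => G s ω) (U 0 ω)

/-- The covariance matrix of a random vector. -/
def covMatrix {n : ℕ} {Ω : Type u} [MeasurableSpace Ω] (P : Measure Ω)
    (V : Ω → Fin n → ℝ) : Matrix (Fin n) (Fin n) ℝ :=
  Matrix.of fun i j => cov[fun ω => V ω i, fun ω => V ω j; P]

/-- The matrix `E (V Wᵀ)`. -/
def crossMoment {n : ℕ} {Ω : Type u} [MeasurableSpace Ω] (P : Measure Ω)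
    (V W : Ω → Fin n → ℝ) : Matrix (Fin n) (Fin n) ℝ :=
  Matrix.of fun i j => ∫ ω, V ω i * W ω j ∂P

/-- The cross-covariance matrix `γ(s) = E (U_s U_0ᵀ)`. -/
def crossCov {n : ℕ} {Ω : Type u} [MeasurableSpace Ω] (P : Measure Ω)
    (U : ℝ → Ω → Fin n → ℝ) (s : ℝ) : Matrix (Fin n) (Fin n) ℝ :=
  crossMoment P (U s) (U 0)

/-! ### The coefficients of the Riccati equation and their estimators -/

/-- `B = ∫_0^t (g(s) - g(s)ᵀ) ds`. -/
def coefB {n : ℕ} (t : ℝ) (g : ℝ → Matrix (Fin n) (Fin n) ℝ) : Matrix (Fin n) (Fin n) ℝ :=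
  Matrix.of fun i j => ∫ s in (0 : ℝ)..t, (g s i j - g s j i)

/-- `C = ∫_0^t ∫_0^t g(s - u) du ds`. -/
def coefC {n : ℕ} (t : ℝ) (g : ℝ → Matrix (Fin n) (Fin n) ℝ) : Matrix (Fin n) (Fin n) ℝ :=
  Matrix.of fun i j => ∫ s in (0 : ℝ)..t, ∫ u in (0 : ℝ)..t, g (s - u) i j

/-- `D = cov(G_t) - cov(U_t - U_0)`. -/
def coefD {n : ℕ} {Ω : Type u} [MeasurableSpace Ω] (P : Measure Ω)
    (G U : ℝ → Ω → Fin n → ℝ) (t : ℝ) : Matrix (Fin n) (Fin n) ℝ :=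
  covMatrix P (G t) - covMatrix P (fun ω => U t ω - U 0 ω)

/-- The extension to negative lags, by `g(-s) = g(s)ᵀ`, of an estimator of the cross-covariance
that is given on `[0,t]`. -/
def reflect {n : ℕ} (g : ℝ → Matrix (Fin n) (Fin n) ℝ) (s : ℝ) : Matrix (Fin n) (Fin n) ℝ :=
  if 0 ≤ s then g s else (g (-s))ᵀ

/-- The estimator of `D` in which `cov(U_t - U_0) = 2 γ(0) - γ(t) - γ(t)ᵀ` is replaced by the same
expression in the estimated cross-covariance `g`; `V` is the covariance matrix of `G_t`. -/
def estD {n : ℕ} (V : Matrix (Fin n) (Fin n) ℝ) (t : ℝ) (g : ℝ → Matrix (Fin n) (Fin n) ℝ) :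
    Matrix (Fin n) (Fin n) ℝ :=
  V - ((2 : ℝ) • g 0 - g t - (g t)ᵀ)

/-- `M` is a positive semidefinite solution of `Bᵀ M + M B - M C M + D = 0`. -/
def IsPSDSolution {n : ℕ} (B C D M : Matrix (Fin n) (Fin n) ℝ) : Prop :=
  M.PosSemidef ∧ Bᵀ * M + M * B - M * C * M + D = 0

open Classical in
/-- The positive semidefinite solution of the Riccati equation with coefficients `B`, `C`, `D` if
there is exactly one, and `0` otherwise. -/
def careSolution {n : ℕ} (B C D : Matrix (Fin n) (Fin n) ℝ) : Matrix (Fin n) (Fin n) ℝ :=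
  if h : ∃! M, IsPSDSolution B C D M then h.choose else 0

/-! ### Convergence in law in the space of continuous functions on `[0,t]` -/

instance instMeasurableSpacePath (t : ℝ) (E : Type v) [TopologicalSpace E] :
    MeasurableSpace C(Set.Icc (0 : ℝ) t, E) := borel _

instance instBorelSpacePath (t : ℝ) (E : Type v) [TopologicalSpace E] :
    BorelSpace C(Set.Icc (0 : ℝ) t, E) := ⟨rfl⟩

open Classical in
/-- A function that is continuous on `[0,t]`, as an element of the space `C([0,t], E)` with the
topology of uniform convergence (and `0` if the function is not continuous on `[0,t]`; it is only
used for functions that are almost surely continuous). -/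
def toPath {E : Type v} [TopologicalSpace E] [Zero E] (t : ℝ) (x : ℝ → E) :
    C(Set.Icc (0 : ℝ) t, E) :=
  if h : ContinuousOn x (Set.Icc 0 t) then ⟨(Set.Icc 0 t).domRestrict x, h.domRestrict⟩ else 0

/-! ### The limits -/

/-- The space `ℝ^{n²}` of vectorized `n × n` matrices. -/
abbrev VecMat (n : ℕ) : Type := Fin n × Fin n → ℝ

/-- `L₁(x)`, a triple of vectors in `ℝ^{n²}`; the entries of `x̃_s` are `x s p.swap`, so that
`x̃_s = vec (Aᵀ)` if `x_s = vec A`. -/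
def L1 {n : ℕ} (t : ℝ) (x : ℝ → VecMat n) : VecMat n × VecMat n × VecMat n :=
  (fun p => ∫ s in (0 : ℝ)..t, (t - s) * (x s p + x s p.swap),
   fun p => ∫ s in (0 : ℝ)..t, (x s p - x s p.swap),
   fun p => x t p + x t p.swap - 2 * x 0 p)

/-- The Kronecker sum `E ⊕ F = (I ⊗ E) + (F ⊗ I)`. -/
def kroneckerSum {n : ℕ} (E F : Matrix (Fin n) (Fin n) ℝ) :
    Matrix (Fin n × Fin n) (Fin n × Fin n) ℝ :=
  (1 : Matrix (Fin n) (Fin n) ℝ) ⊗ₖ E + F ⊗ₖ (1 : Matrix (Fin n) (Fin n) ℝ)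

/-- The permutation `vec A ↦ vec (Aᵀ)` of coordinates. -/
def transposeVec (n : ℕ) : VecMat n →ₗ[ℝ] VecMat n :=
  LinearMap.funLeft ℝ ℝ Prod.swap

/-- The linear map
`(c, b, d) ↦ (Θ ⊗ Θ) c - d - (Θ ⊗ I) b̃ - (I ⊗ Θ) b`, where `b̃ = vec (Aᵀ)` if `b = vec A`. -/
def L2star {n : ℕ} (Θ : Matrix (Fin n) (Fin n) ℝ) :
    (VecMat n × VecMat n × VecMat n) →ₗ[ℝ] VecMat n :=
  (Θ ⊗ₖ Θ).mulVecLin ∘ₗ LinearMap.fst ℝ _ _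
    - LinearMap.snd ℝ _ _ ∘ₗ LinearMap.snd ℝ _ _
    - (Θ ⊗ₖ (1 : Matrix (Fin n) (Fin n) ℝ)).mulVecLin ∘ₗ transposeVec n ∘ₗ
        LinearMap.fst ℝ _ _ ∘ₗ LinearMap.snd ℝ _ _
    - ((1 : Matrix (Fin n) (Fin n) ℝ) ⊗ₖ Θ).mulVecLin ∘ₗ
        LinearMap.fst ℝ _ _ ∘ₗ LinearMap.snd ℝ _ _

/-- `L₂ = (Φᵀ ⊕ Φᵀ)⁻¹ L₂*` with `Φ = B - C Θ`. -/
def L2 {n : ℕ} (Θ B C : Matrix (Fin n) (Fin n) ℝ) :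
    (VecMat n × VecMat n × VecMat n) →ₗ[ℝ] VecMat n :=
  ((kroneckerSum (B - C * Θ)ᵀ (B - C * Θ)ᵀ)⁻¹).mulVecLin ∘ₗ L2star Θ

end Langevin

end

/-!
# Convergence in law of the estimator of the drift matrix

By variation of constants, the stationary solution is the moving average
`U_s = ∫_{-∞}^0 Θ e^{Θ r} (G_s - G_{s+r}) dr` of the increments of the noise
(`langevin_eq_integral`). The increments have `L²` norms of at most linear growth and the kernel decays
exponentially, so that Fubini's theorem expresses all second moments of `U` by those of the increments
of `G` (`LangevinSystem.integral_solution_mul_solution`). Consequently `U` is centred and stationary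
to second order, and its cross-covariance `γ` is determined by `Θ` and the cross-covariance of `G`.
Computing the covariance matrix of `G_t = (U_t - U_0) + Θ ∫_0^t U_s ds` then shows that `Θ` solves the
Riccati equation with the coefficients `B`, `C`, `D` (`LangevinSystem.isPSDSolution`).

The errors of the coefficients are the image of the error of `γ` under the continuous linear map `L₁`;
for `C` this rests on `C = ∫_0^t (t - s) (γ(s) + γ(s)ᵀ) ds`. The convergence in law of the
coefficients is therefore an instance of the continuous mapping theorem.

The convergence in law of the estimated drift matrix follows by the delta method
(`tendstoInDistribution_of_hasFDerivAt`). If `C` and `D` are positive definite and `M` is a positive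
semidefinite solution of the Riccati equation, then `M` is a Lyapunov function for `B - C M`, which is
therefore stable. For stable matrices the Sylvester equation has only the trivial solution
(`eq_zero_of_sylvester`). This yields both the uniqueness of positive semidefinite solutions and the
invertibility of the Kronecker sum, which is the derivative of the Riccati equation in the unknown. By
the implicit function theorem there is a differentiable branch of solutions near `Θ`; it is symmetric,
and hence the positive semidefinite solution, as long as `C` and `D` are symmetric. The derivative of
this branch is `L₂` (`exists_hasFDerivAt_careVec`). Measurability of the estimator holds globally, since
the solutions of the Riccati equation form a closed, hence `σ`-compact, set
(`measurable_of_isClosed_of_existsUnique`).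
-/

noncomputable section

namespace Langevin

/-! ### Second-order calculus for random integrals -/

section SecondOrder

variable {α β Ω : Type*} [MeasurableSpace α] [MeasurableSpace β] [MeasurableSpace Ω]
  {μ : Measure α} {ν : Measure β} {P : Measure Ω} [SFinite ν]
  {f : α → Ω → ℝ} {g : β → Ω → ℝ} {a : α → ℝ≥0∞} {b : β → ℝ≥0∞}

/-- By the Cauchy-Schwarz inequality, integrable bounds on the `L²` norms of two families of random
variables make the product of the two families jointly integrable. -/
theorem integrable_mul_of_eLpNorm_le [SFinite P]
    (hf : Measurable (Function.uncurry f)) (hg : Measurable (Function.uncurry g))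
    (ha : Measurable a) (hb : Measurable b)
    (hfa : ∀ r, eLpNorm (f r) 2 P ≤ a r) (hgb : ∀ q, eLpNorm (g q) 2 P ≤ b q)
    (haI : ∫⁻ r, a r ∂μ < ∞) (hbI : ∫⁻ q, b q ∂ν < ∞) :
    Integrable (fun z : (α × β) × Ω => f z.1.1 z.2 * g z.1.2 z.2) ((μ.prod ν).prod P) := by
  have hm : Measurable (fun z : (α × β) × Ω => f z.1.1 z.2 * g z.1.2 z.2) :=
    (hf.comp (measurable_fst.fst.prodMk measurable_snd)).mul
      (hg.comp (measurable_fst.snd.prodMk measurable_snd))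
  refine ⟨hm.aestronglyMeasurable, ?_⟩
  rw [HasFiniteIntegral, lintegral_prod _ hm.enorm.aemeasurable]
  have hfr : ∀ r, Measurable (f r) := fun r => hf.comp measurable_prodMk_left
  have hgr : ∀ r, Measurable (g r) := fun r => hg.comp measurable_prodMk_left
  calc ∫⁻ z : α × β, ∫⁻ ω, ‖f z.1 ω * g z.2 ω‖ₑ ∂P ∂(μ.prod ν)
      ≤ ∫⁻ z : α × β, a z.1 * b z.2 ∂(μ.prod ν) := by
        refine lintegral_mono fun z => ?_
        have h := eLpNorm_smul_le_mul_eLpNorm (p := 2) (q := 2) (r := 1)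
          (hgr z.2).aestronglyMeasurable (hfr z.1).aestronglyMeasurable (μ := P)
        rw [eLpNorm_one_eq_lintegral_enorm] at h
        exact h.trans (mul_le_mul' (hfa _) (hgb _))
    _ = (∫⁻ r, a r ∂μ) * ∫⁻ q, b q ∂ν := lintegral_prod_mul ha.aemeasurable hb.aemeasurable
    _ < ∞ := ENNReal.mul_lt_top haI hbI

/-- A family of random variables with integrable `L²` norms is jointly integrable. -/
theorem integrable_uncurry_of_eLpNorm_le [IsProbabilityMeasure P]
    (hf : Measurable (Function.uncurry f))
    (hfa : ∀ r, eLpNorm (f r) 2 P ≤ a r) (haI : ∫⁻ r, a r ∂μ < ∞) :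
    Integrable (Function.uncurry f) (μ.prod P) := by
  refine ⟨hf.aestronglyMeasurable, ?_⟩
  rw [HasFiniteIntegral, lintegral_prod _ hf.enorm.aemeasurable]
  refine lt_of_le_of_lt (lintegral_mono fun r => ?_) haI
  have hfr : Measurable (f r) := hf.comp measurable_prodMk_left
  have h : eLpNorm (f r) 1 P ≤ eLpNorm (f r) 2 P :=
    eLpNorm_le_eLpNorm_of_exponent_le (by norm_num) hfr.aestronglyMeasurable
  rw [eLpNorm_one_eq_lintegral_enorm] at h
  exact h.trans (hfa r)

theorem measurable_integral_of_uncurry [SFinite μ] (hf : Measurable (Function.uncurry f)) :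
    Measurable fun ω => ∫ r, f r ω ∂μ := by
  have h : StronglyMeasurable fun z : Ω × α => f z.2 z.1 :=
    (hf.comp measurable_swap).stronglyMeasurable
  exact h.integral_prod_right.measurable

/-- The integral of a family of random variables with integrable `L²` norms is in `L²`. -/
theorem memLp_two_integral [SFinite μ] [SFinite P]
    (hf : Measurable (Function.uncurry f)) (ha : Measurable a)
    (hfa : ∀ r, eLpNorm (f r) 2 P ≤ a r) (haI : ∫⁻ r, a r ∂μ < ∞) :
    MemLp (fun ω => ∫ r, f r ω ∂μ) 2 P := by
  rw [memLp_two_iff_integrable_sq (measurable_integral_of_uncurry hf).aestronglyMeasurable]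
  have h := (integrable_mul_of_eLpNorm_le hf hf ha ha hfa hfa haI haI).integral_prod_right
  refine h.congr (ae_of_all _ fun ω => ?_)
  simp only
  rw [integral_prod_mul (fun r => f r ω) (fun r => f r ω), sq]

/-- Expectation and integration can be interchanged in a product of two random integrals. -/
theorem integral_integral_mul_integral [SFinite μ] [SFinite P]
    (hf : Measurable (Function.uncurry f)) (hg : Measurable (Function.uncurry g))
    (ha : Measurable a) (hb : Measurable b)
    (hfa : ∀ r, eLpNorm (f r) 2 P ≤ a r) (hgb : ∀ q, eLpNorm (g q) 2 P ≤ b q)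
    (haI : ∫⁻ r, a r ∂μ < ∞) (hbI : ∫⁻ q, b q ∂ν < ∞) :
    ∫ ω, (∫ r, f r ω ∂μ) * ∫ q, g q ω ∂ν ∂P = ∫ r, ∫ q, ∫ ω, f r ω * g q ω ∂P ∂ν ∂μ := by
  have h := integrable_mul_of_eLpNorm_le hf hg ha hb hfa hgb haI hbI
  have h1 := h.integral_prod_left
  rw [← integral_prod (fun z : α × β => ∫ ω, f z.1 ω * g z.2 ω ∂P) h1]
  rw [← integral_prod _ h, integral_prod_symm _ h]
  refine integral_congr_ae (ae_of_all _ fun ω => ?_)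
  exact (integral_prod_mul (fun r => f r ω) (fun q => g q ω)).symm

/-- Expectation and integration can be interchanged in the product of a random integral and a random
variable. -/
theorem integral_integral_mul [SFinite μ] [IsProbabilityMeasure P] {V : Ω → ℝ}
    (hf : Measurable (Function.uncurry f)) (hV : Measurable V) (hV2 : MemLp V 2 P)
    (ha : Measurable a) (hfa : ∀ r, eLpNorm (f r) 2 P ≤ a r) (haI : ∫⁻ r, a r ∂μ < ∞) :
    Integrable (fun r => ∫ ω, f r ω * V ω ∂P) μ ∧
      ∫ ω, (∫ r, f r ω ∂μ) * V ω ∂P = ∫ r, ∫ ω, f r ω * V ω ∂P ∂μ := by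
  have hg : Measurable (Function.uncurry fun _ : Unit => V) := hV.comp measurable_snd
  have hbI : ∫⁻ _ : Unit, eLpNorm V 2 P ∂(Measure.dirac ()) < ∞ := by
    simpa using hV2.eLpNorm_lt_top
  constructor
  · have h := (integrable_mul_of_eLpNorm_le hf hg ha (measurable_const (a := eLpNorm V 2 P)) hfa
      (fun _ => le_rfl) haI hbI).integral_prod_left.integral_prod_left
    simpa using h
  · simpa using integral_integral_mul_integral hf hg ha (measurable_const (a := eLpNorm V 2 P)) hfa
      (fun _ => le_rfl) haI hbI

end SecondOrder

/-- An almost surely continuous process has a jointly measurable version all of whose paths are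
continuous, and which almost surely agrees with the process at all times. -/
theorem exists_continuous_version {Ω E : Type*} [MeasurableSpace Ω] {P : Measure Ω}
    [TopologicalSpace E] [TopologicalSpace.MetrizableSpace E] [MeasurableSpace E] [BorelSpace E]
    [Zero E]
    {X : ℝ → Ω → E} (hX : ∀ s, AEMeasurable (X s) P)
    (hc : ∀ᵐ ω ∂P, Continuous fun s => X s ω) :
    ∃ Y : ℝ → Ω → E, Measurable (Function.uncurry Y) ∧ (∀ ω, Continuous fun s => Y s ω) ∧
      ∀ᵐ ω ∂P, ∀ s, Y s ω = X s ω := by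
  classical
  have hq : ∀ᵐ ω ∂P, (Continuous fun s => X s ω) ∧ ∀ q : ℚ, X q ω = (hX q).mk _ ω :=
    hc.and (ae_all_iff.2 fun q => (hX q).ae_eq_mk)
  obtain ⟨A, hAsub, hA, hA0⟩ := exists_measurable_superset_of_null hq
  let Y : ℝ → Ω → E := fun s => (Aᶜ).piecewise (X s) 0
  have hYc : ∀ ω, Continuous fun s => Y s ω := by
    intro ω
    by_cases h : ω ∈ Aᶜ
    · have h' : (Continuous fun s => X s ω) ∧ ∀ q : ℚ, X q ω = (hX q).mk _ ω := by
        by_contra h''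
        exact h (hAsub h'')
      simpa [Y, Set.piecewise, h] using h'.1
    · simpa [Y, Set.piecewise, h] using continuous_const
  have hYq : ∀ q : ℚ, Measurable (Y q) := by
    intro q
    have : Y q = (Aᶜ).piecewise ((hX q).mk _) 0 := by
      ext ω
      by_cases h : ω ∈ Aᶜ
      · have h' : (Continuous fun s => X s ω) ∧ ∀ q : ℚ, X q ω = (hX q).mk _ ω := by
          by_contra h''
          exact h (hAsub h'')
        simpa [Y, Set.piecewise, h] using h'.2 q
      · simp [Y, Set.piecewise, h]
    rw [this]
    exact (hX q).measurable_mk.piecewise hA.compl measurable_zero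
  have hYs : ∀ s, Measurable (Y s) := by
    intro s
    obtain ⟨u, hu⟩ : ∃ u : ℕ → ℚ, Tendsto (fun n => (u n : ℝ)) atTop (𝓝 s) := by
      obtain ⟨u, -, -, hu⟩ := Real.exists_seq_rat_strictMono_tendsto s
      exact ⟨u, hu⟩
    refine measurable_of_tendsto_metrizable (fun n => hYq (u n)) ?_
    rw [tendsto_pi_nhds]
    intro ω
    exact ((hYc ω).tendsto s).comp hu
  refine ⟨Y, ?_, hYc, ?_⟩
  · have := measurable_uncurry_of_continuous_of_measurable (u := fun s ω => Y s ω) hYc hYs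
    exact this
  · have : ∀ᵐ ω ∂P, ω ∈ Aᶜ := by
      rw [ae_iff]; simpa using hA0
    filter_upwards [this] with ω hω s
    simp only [Y, Set.piecewise, hω, if_true]

/-! ### The stationary solution of the Langevin equation along a path -/

/-- The scalar Langevin equation with the initial value `g_0 - c ∫_{-∞}^0 e^{c r} g_r dr`: the solution
is a moving average of the increments of `g`. -/
theorem scalar_langevin_eq_integral {c : ℝ} (hc : 0 < c) {g y : ℝ → ℝ} (hg : Continuous g)
    (hy : Continuous y) (hsol : ∀ a b : ℝ, a ≤ b → y b - y a = -(c * ∫ s in a..b, y s) + (g b - g a))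
    (hint : IntegrableOn (fun r => Real.exp (c * r) * g r) (Set.Iic 0)) {I : ℝ}
    (hI : Tendsto (fun s : ℝ => ∫ r in s..0, Real.exp (c * r) * g r) atBot (𝓝 I))
    (h0 : y 0 = g 0 - c * I) (s : ℝ) :
    IntegrableOn (fun r => c * Real.exp (c * r) * (g s - g (s + r))) (Set.Iic 0) ∧
      y s = ∫ r in Set.Iic 0, c * Real.exp (c * r) * (g s - g (s + r)) := by
  have hcont : Continuous fun r => Real.exp (c * r) * g r := by fun_prop
  have hint' : ∀ s, IntegrableOn (fun r => Real.exp (c * r) * g r) (Set.Iic s) := by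
    intro s
    rcases le_total s 0 with h | h
    · exact hint.mono_set (Set.Iic_subset_Iic.2 h)
    · rw [← Set.Iic_union_Icc_eq_Iic h]
      exact hint.union hcont.continuousOn.integrableOn_Icc
  have hI' : I = ∫ r in Set.Iic 0, Real.exp (c * r) * g r :=
    tendsto_nhds_unique hI (intervalIntegral_tendsto_integral_Iic 0 hint tendsto_id)
  -- Variation of constants: `e^{c s} (y_s - g_s)` has the derivative `-c e^{c s} g_s`.
  have hsol' : ∀ x, y x = g x + (y 0 - g 0) - c * ∫ u in (0 : ℝ)..x, y u := by
    intro x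
    rcases le_total 0 x with h | h
    · linarith [hsol 0 x h]
    · rw [intervalIntegral.integral_symm]; linarith [hsol x 0 h]
  have hder : ∀ x, HasDerivAt (fun x => Real.exp (c * x) * (y x - g x))
      (-(c * (Real.exp (c * x) * g x))) x := by
    intro x
    have h1 : HasDerivAt (fun x => y x - g x) (-(c * y x)) x := by
      have h2 : HasDerivAt (fun x => ∫ u in (0 : ℝ)..x, y u) (y x) x :=
        intervalIntegral.integral_hasDerivAt_right (hy.intervalIntegrable _ _)
          (hy.stronglyMeasurableAtFilter _ _) hy.continuousAt
      have h3 := (h2.const_mul c).const_sub (y 0 - g 0)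
      refine h3.congr_of_eventuallyEq (Eventually.of_forall fun z => ?_)
      simp only
      linarith [hsol' z]
    have h4 : HasDerivAt (fun x => Real.exp (c * x)) (Real.exp (c * x) * c) x := by
      simpa using ((hasDerivAt_id x).const_mul c).exp
    have h5 := h4.mul h1
    exact h5.congr_deriv (by ring)
  have hfund : Real.exp (c * s) * (y s - g s) - (y 0 - g 0) =
      -(c * ∫ r in (0 : ℝ)..s, Real.exp (c * r) * g r) := by
    have h := intervalIntegral.integral_eq_sub_of_hasDerivAt (a := 0) (b := s)
      (fun x _ => hder x) ((by fun_prop : Continuous fun x =>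
        -(c * (Real.exp (c * x) * g x))).intervalIntegrable _ _)
    simp only [intervalIntegral.integral_neg, intervalIntegral.integral_const_mul] at h
    rw [h]; simp
  have hIs : ∫ r in Set.Iic s, Real.exp (c * r) * g r =
      I + ∫ r in (0 : ℝ)..s, Real.exp (c * r) * g r := by
    rw [hI', ← intervalIntegral.integral_Iic_sub_Iic (hint' 0) (hint' s)]; ring
  have hy1 : y s = g s - Real.exp (-(c * s)) * (c * ∫ r in Set.Iic s, Real.exp (c * r) * g r) := by
    rw [hIs]
    have : Real.exp (c * s) * (y s - g s) =
      -(c * (I + ∫ r in (0 : ℝ)..s, Real.exp (c * r) * g r)) := by linarith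
    rw [Real.exp_neg]
    have he := Real.exp_pos (c * s)
    field_simp
    linarith
  have hshift : MeasurePreserving (fun r : ℝ => s + r) (volume.restrict (Set.Iic 0))
      (volume.restrict (Set.Iic s)) := by
    have := (measurePreserving_add_left (volume : Measure ℝ) s).restrict_preimage
      (measurableSet_Iic (a := s))
    simpa using this
  have hemb : MeasurableEmbedding (fun r : ℝ => s + r) := measurableEmbedding_addLeft s
  have hint2 : IntegrableOn (fun r => Real.exp (c * (s + r)) * g (s + r)) (Set.Iic 0) :=
    (hshift.integrable_comp_emb hemb).2 (hint' s)
  have heq2 : ∫ r in Set.Iic 0, Real.exp (c * (s + r)) * g (s + r) =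
      ∫ r in Set.Iic s, Real.exp (c * r) * g r :=
    hshift.integral_comp hemb (fun r => Real.exp (c * r) * g r)
  have hexp : IntegrableOn (fun r => Real.exp (c * r)) (Set.Iic 0) := by
    simpa using integrableOn_exp_mul_Iic hc 0
  have hexp1 : ∫ r in Set.Iic 0, Real.exp (c * r) = 1 / c := by
    simpa using integral_exp_mul_Iic hc 0
  have hfun : (fun r => c * Real.exp (c * r) * (g s - g (s + r))) = fun r =>
      c * g s * Real.exp (c * r) -
        c * Real.exp (-(c * s)) * (Real.exp (c * (s + r)) * g (s + r)) := by
    ext r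
    have : Real.exp (c * r) = Real.exp (-(c * s)) * Real.exp (c * (s + r)) := by
      rw [← Real.exp_add]; congr 1; ring
    rw [mul_sub, this]; ring
  have hi1 := hexp.const_mul (c * g s)
  have hi2 := hint2.const_mul (c * Real.exp (-(c * s)))
  constructor
  · rw [hfun]; exact hi1.sub hi2
  · rw [hfun, integral_sub hi1 hi2, integral_const_mul, integral_const_mul, heq2, hexp1, hy1]
    field_simp

/-- The kernel `Θ e^{Θ r}` of the moving-average representation of the stationary solution. -/
def maKernel {n : ℕ} (Θ : Matrix (Fin n) (Fin n) ℝ) (r : ℝ) : Matrix (Fin n) (Fin n) ℝ :=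
  Θ * NormedSpace.exp (r • Θ)

theorem exists_diagonalization {n : ℕ} {Θ : Matrix (Fin n) (Fin n) ℝ} (h : Θ.PosDef) :
    ∃ (O : Matrix (Fin n) (Fin n) ℝ) (c : Fin n → ℝ), (∀ k, 0 < c k) ∧ O * Oᵀ = 1 ∧ Oᵀ * O = 1 ∧
      Θ = O * Matrix.diagonal c * Oᵀ ∧
      ∀ r : ℝ, NormedSpace.exp (r • Θ) = O * Matrix.diagonal (fun k => Real.exp (c k * r)) * Oᵀ := by
  let O : Matrix (Fin n) (Fin n) ℝ := h.1.eigenvectorUnitary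
  have hstar : star O = Oᵀ := by
    rw [Matrix.star_eq_conjTranspose, Matrix.conjTranspose_eq_transpose_of_trivial]
  have h1 : O * Oᵀ = 1 := by
    rw [← hstar]; exact Unitary.mul_star_self_of_mem h.1.eigenvectorUnitary.2
  have h2 : Oᵀ * O = 1 := by
    rw [← hstar]; exact Unitary.star_mul_self_of_mem h.1.eigenvectorUnitary.2
  have h3 : Θ = O * Matrix.diagonal h.1.eigenvalues * Oᵀ := by
    have := h.1.spectral_theorem
    rw [Unitary.conjStarAlgAut_apply] at this
    rw [← hstar]
    exact this
  have hinv : O⁻¹ = Oᵀ := Matrix.inv_eq_right_inv h1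
  refine ⟨O, h.1.eigenvalues, h.eigenvalues_pos, h1, h2, h3, fun r => ?_⟩
  have hr : r • Θ = O * Matrix.diagonal (fun k => h.1.eigenvalues k * r) * O⁻¹ := by
    rw [hinv]
    conv_lhs => rw [h3]
    rw [← Matrix.smul_mul, ← Matrix.mul_smul, ← Matrix.diagonal_smul]
    congr 3
    ext k
    simp [mul_comm]
  have hu : IsUnit O := ⟨⟨O, Oᵀ, h1, h2⟩, rfl⟩
  rw [hr, Matrix.exp_conj _ _ hu, Matrix.exp_diagonal, hinv]
  congr 3
  ext k
  simp [Pi.coe_exp, Real.exp_eq_exp_ℝ]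

/-- The stationary solution is a moving average of the increments of the noise. Integrating against
increments, rather than against `g` itself, makes the stationarity of the solution apparent. -/
theorem langevin_eq_integral {n : ℕ} {Θ : Matrix (Fin n) (Fin n) ℝ} (hΘ : Θ.PosDef)
    {g y : ℝ → Fin n → ℝ} (hg : Continuous g) (hy : Continuous y)
    (hsol : ∀ a b : ℝ, a ≤ b → y b - y a = -(Θ *ᵥ ∫ s in a..b, y s) + (g b - g a))
    (hint : ∀ c : ℝ, 0 < c → ∀ j, IntegrableOn (fun r => Real.exp (c * r) * g r j) (Set.Iic 0))
    (h0 : HasImproperIntegral Θ g (y 0)) (s : ℝ) (i : Fin n) :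
    y s i = ∫ r in Set.Iic 0, (maKernel Θ r *ᵥ (g s - g (s + r))) i := by
  obtain ⟨O, c, hc, hO1, hO2, hΘO, hexp⟩ := exists_diagonalization hΘ
  obtain ⟨I, hI, hy0⟩ := h0
  -- The coordinates with respect to the eigenvectors of `Θ` satisfy scalar equations.
  let L : Fin n → (Fin n → ℝ) →L[ℝ] ℝ := fun k =>
    (ContinuousLinearMap.proj k).comp (Matrix.mulVecLin Oᵀ).toContinuousLinearMap
  have hL : ∀ k x, L k x = (Oᵀ *ᵥ x) k := fun k x => rfl
  have hdiag : ∀ (d : Fin n → ℝ) k x,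
      L k ((O * Matrix.diagonal d * Oᵀ) *ᵥ x) = d k * L k x := by
    intro d k x
    rw [hL, hL, Matrix.mulVec_mulVec, ← Matrix.mul_assoc, ← Matrix.mul_assoc, hO2, Matrix.one_mul,
      ← Matrix.mulVec_mulVec, Matrix.mulVec_diagonal]
  have hLΘ : ∀ k x, L k (Θ *ᵥ x) = c k * L k x := by
    intro k x
    conv_lhs => rw [hΘO]
    exact hdiag c k x
  have hLexp : ∀ k (r : ℝ) x, L k (NormedSpace.exp (r • Θ) *ᵥ x) = Real.exp (c k * r) * L k x := by
    intro k r x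
    rw [hexp]; exact hdiag _ k x
  have hrec : ∀ x : Fin n → ℝ, x = O *ᵥ fun k => L k x := by
    intro x
    have : (fun k => L k x) = Oᵀ *ᵥ x := rfl
    rw [this, Matrix.mulVec_mulVec, hO1, Matrix.one_mulVec]
  have hcexp : Continuous fun u : ℝ => NormedSpace.exp (u • Θ) *ᵥ g u := by
    have : (fun u : ℝ => NormedSpace.exp (u • Θ)) =
        fun u => O * Matrix.diagonal (fun k => Real.exp (c k * u)) * Oᵀ := funext hexp
    have h2 : Continuous fun u : ℝ => NormedSpace.exp (u • Θ) := by
      rw [this]; fun_prop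
    exact h2.matrix_mulVec hg
  have hk : ∀ k, IntegrableOn (fun r => c k * Real.exp (c k * r) * (L k (g s) - L k (g (s + r))))
        (Set.Iic 0) ∧
      L k (y s) = ∫ r in Set.Iic 0, c k * Real.exp (c k * r) * (L k (g s) - L k (g (s + r))) := by
    intro k
    refine scalar_langevin_eq_integral (hc k) (g := fun r => L k (g r)) (y := fun r => L k (y r))
      (I := L k I) ((L k).continuous.comp hg) ((L k).continuous.comp hy) ?_ ?_ ?_ ?_ s
    · intro a b hab
      rw [(L k).intervalIntegral_comp_comm (hy.intervalIntegrable a b), ← hLΘ, ← map_sub, ← map_sub,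
        hsol a b hab, map_add, map_neg]
    · have : (fun r => Real.exp (c k * r) * L k (g r)) =
          fun r => ∑ j, O j k * (Real.exp (c k * r) * g r j) := by
        ext r
        rw [hL, Matrix.mulVec, dotProduct, Finset.mul_sum]
        refine Finset.sum_congr rfl fun j _ => ?_
        rw [Matrix.transpose_apply]; ring
      rw [this]
      exact integrable_finsetSum _ fun j _ => (hint (c k) (hc k) j).const_mul _
    · have := ((L k).continuous.tendsto I).comp hI
      refine this.congr fun x => ?_
      rw [Function.comp, ← (L k).intervalIntegral_comp_comm (hcexp.intervalIntegrable x 0)]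
      simp only [hLexp]
    · rw [hy0, map_sub, hLΘ]
  have hker : ∀ r x, (maKernel Θ r *ᵥ x) i = ∑ k, O i k * (c k * Real.exp (c k * r) * L k x) := by
    intro r x
    rw [hrec (maKernel Θ r *ᵥ x), Matrix.mulVec, dotProduct]
    refine Finset.sum_congr rfl fun k _ => ?_
    rw [maKernel, ← Matrix.mulVec_mulVec, hLΘ, hLexp, mul_assoc]
  simp_rw [hker, map_sub]
  rw [integral_finsetSum _ fun k _ => (hk k).1.const_mul _]
  conv_lhs => rw [hrec (y s), Matrix.mulVec, dotProduct]
  refine Finset.sum_congr rfl fun k _ => ?_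
  rw [integral_const_mul, (hk k).2]

theorem continuous_maKernel {n : ℕ} {Θ : Matrix (Fin n) (Fin n) ℝ} (hΘ : Θ.PosDef) :
    Continuous (maKernel Θ) := by
  obtain ⟨O, c, hc, hO1, hO2, hΘO, hexp⟩ := exists_diagonalization hΘ
  have : maKernel Θ = fun u => Θ * (O * Matrix.diagonal (fun k => Real.exp (c k * u)) * Oᵀ) := by
    ext1 u; rw [maKernel, hexp]
  rw [this]; fun_prop

/-- The kernel decays exponentially at `-∞`. -/
theorem exists_maKernel_le {n : ℕ} {Θ : Matrix (Fin n) (Fin n) ℝ} (hΘ : Θ.PosDef) :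
    ∃ K c : ℝ, 0 < c ∧ ∀ r ≤ 0, ∀ i j, |maKernel Θ r i j| ≤ K * Real.exp (c * r) := by
  obtain ⟨O, c, hc, hO1, hO2, hΘO, hexp⟩ := exists_diagonalization hΘ
  obtain ⟨c₀, hc₀, hle⟩ : ∃ c₀ : ℝ, 0 < c₀ ∧ ∀ k, c₀ ≤ c k := by
    rcases isEmpty_or_nonempty (Fin n) with h | h
    · exact ⟨1, one_pos, fun k => h.elim k⟩
    · obtain ⟨k, hk⟩ := Finite.exists_min c
      exact ⟨c k, hc k, hk⟩
  have hentry : ∀ r i j, maKernel Θ r i j = ∑ k, (Θ * O) i k * Oᵀ k j * Real.exp (c k * r) := by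
    intro r i j
    rw [maKernel, hexp, ← Matrix.mul_assoc, ← Matrix.mul_assoc, Matrix.mul_apply]
    refine Finset.sum_congr rfl fun k _ => ?_
    rw [Matrix.mul_diagonal]; ring
  refine ⟨∑ i, ∑ j, ∑ k, |(Θ * O) i k * Oᵀ k j|, c₀, hc₀, fun r hr i j => ?_⟩
  rw [hentry]
  calc |∑ k, (Θ * O) i k * Oᵀ k j * Real.exp (c k * r)|
      ≤ ∑ k, |(Θ * O) i k * Oᵀ k j| * Real.exp (c₀ * r) := by
        refine (Finset.abs_sum_le_sum_abs _ _).trans (Finset.sum_le_sum fun k _ => ?_)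
        rw [abs_mul, abs_of_pos (Real.exp_pos _)]
        gcongr ?_ * Real.exp ?_
        exact mul_le_mul_of_nonpos_right (hle k) hr
    _ = (∑ k, |(Θ * O) i k * Oᵀ k j|) * Real.exp (c₀ * r) := by rw [Finset.sum_mul]
    _ ≤ _ := by
        refine mul_le_mul_of_nonneg_right ?_ (Real.exp_pos _).le
        refine le_trans ?_ (Finset.single_le_sum (f := fun i => ∑ j, ∑ k, |(Θ * O) i k * Oᵀ k j|)
          (fun _ _ => by positivity) (Finset.mem_univ i))
        exact Finset.single_le_sum (f := fun j => ∑ k, |(Θ * O) i k * Oᵀ k j|)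
          (fun _ _ => by positivity) (Finset.mem_univ j)

/-! ### Second moments of the noise -/

namespace LangevinSystem

variable {n : ℕ} {Ω : Type u} [MeasurableSpace Ω] {P : Measure Ω}
  {Θ : Matrix (Fin n) (Fin n) ℝ} {G U : ℝ → Ω → Fin n → ℝ}

theorem aemeasurable_apply (hS : LangevinSystem P Θ G U) (s : ℝ) (i : Fin n) :
    AEMeasurable (fun ω => G s ω i) P :=
  (measurable_pi_apply i).comp_aemeasurable (hS.aemeasurable s)

/-- The second moments of increments are invariant under shifts. -/
theorem integral_increment_mul_increment (hS : LangevinSystem P Θ G U) (h a b c d : ℝ)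
    (i j : Fin n) :
    ∫ ω, (G (b + h) ω i - G (a + h) ω i) * (G (d + h) ω j - G (c + h) ω j) ∂P =
      ∫ ω, (G b ω i - G a ω i) * (G d ω j - G c ω j) ∂P := by
  have hp : Measurable fun x : Fin 4 → Fin n → ℝ => (x 1 i - x 0 i) * (x 3 j - x 2 j) := by
    fun_prop
  have := ((hS.stationaryIncrements h 4 ![a, b, c, d]).comp hp).integral_eq
  simpa [Function.comp_def] using this

theorem eLpNorm_increment (hS : LangevinSystem P Θ G U) (h s : ℝ) (i : Fin n) :
    eLpNorm (fun ω => G (s + h) ω i - G h ω i) 2 P = eLpNorm (fun ω => G s ω i) 2 P := by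
  have hp : Measurable fun x : Fin 1 → Fin n → ℝ => x 0 i := by fun_prop
  have h1 := ((hS.stationaryIncrements h 1 ![s]).comp hp).eLpNorm_eq (p := 2)
  simp only [Function.comp_def, Matrix.cons_val_fin_one, Pi.sub_apply] at h1
  rw [h1]
  refine eLpNorm_congr_ae ?_
  filter_upwards [hS.zero] with ω hω
  simp [hω]

/-- The `L²` norm of the noise grows at most linearly in time, since increments over unit time
intervals are bounded in `L²`. -/
theorem exists_eLpNorm_le (hS : LangevinSystem P Θ G U) :
    ∃ K : ℝ, 0 ≤ K ∧ ∀ s i, eLpNorm (fun ω => G s ω i) 2 P ≤ ENNReal.ofReal (K * (1 + |s|)) := by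
  let N : ℝ → Fin n → ℝ≥0∞ := fun s i => eLpNorm (fun ω => G s ω i) 2 P
  let S : Fin n → ℝ≥0∞ := fun i =>
    (⨆ s ∈ Set.Icc (0 : ℝ) 1, ∫⁻ ω, ‖G s ω i‖ₑ ^ 2 ∂P) ^ (1 / 2 : ℝ)
  have hSfin : ∀ i, S i < ∞ := fun i =>
    ENNReal.rpow_lt_top_of_nonneg (by norm_num) (hS.secondMoment i).ne
  have hN1 : ∀ s ∈ Set.Icc (0 : ℝ) 1, ∀ i, N s i ≤ ∑ j, S j := by
    intro s hs i
    refine le_trans ?_ (Finset.single_le_sum (f := S) (fun _ _ => zero_le) (Finset.mem_univ i))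
    simp only [N, S, eLpNorm_eq_lintegral_rpow_enorm_toReal (p := 2) (by norm_num) (by norm_num)]
    simp only [ENNReal.toReal_ofNat]
    refine ENNReal.rpow_le_rpow ?_ (by norm_num)
    refine le_trans (le_of_eq ?_)
      (le_iSup₂ (f := fun (s : ℝ) (_ : s ∈ Set.Icc (0 : ℝ) 1) => ∫⁻ ω, ‖G s ω i‖ₑ ^ 2 ∂P) s hs)
    simp
  set K₀ := ∑ j, S j
  have hK₀ : K₀ ≠ ∞ := (ENNReal.sum_lt_top.2 fun i _ => hSfin i).ne
  have hN0 : ∀ i, N 0 i = 0 := by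
    intro i
    refine (eLpNorm_congr_ae (g := fun _ => (0 : ℝ)) ?_).trans eLpNorm_zero
    filter_upwards [hS.zero] with ω hω
    simp [hω]
  have hnat : ∀ m : ℕ, ∀ s : ℝ, 0 ≤ s → s ≤ m → ∀ i, N s i ≤ m * K₀ := by
    intro m
    induction m with
    | zero =>
      intro s h0 h1 i
      have : s = 0 := le_antisymm (by simpa using h1) h0
      simp [this, hN0]
    | succ m ih =>
      intro s h0 h1 i
      push_cast at h1 ⊢
      rcases le_total s 1 with h | h
      · calc N s i ≤ K₀ := hN1 s ⟨h0, h⟩ i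
          _ = 0 + 1 * K₀ := by simp
          _ ≤ (m + 1) * K₀ := by rw [add_mul]; gcongr; exact zero_le
      · have h2 : N s i ≤ eLpNorm (fun ω => G (1 + (s - 1)) ω i - G (s - 1) ω i) 2 P +
            N (s - 1) i := by
          have := eLpNorm_add_le (μ := P) (p := 2)
            ((hS.aemeasurable_apply (1 + (s - 1)) i).sub
              (hS.aemeasurable_apply (s - 1) i)).aestronglyMeasurable
            (hS.aemeasurable_apply (s - 1) i).aestronglyMeasurable (by norm_num)
          refine le_trans (le_of_eq ?_) this
          refine eLpNorm_congr_ae (ae_of_all _ fun ω => ?_)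
          simp
        rw [hS.eLpNorm_increment] at h2
        calc N s i ≤ N 1 i + N (s - 1) i := h2
          _ ≤ K₀ + m * K₀ := add_le_add (hN1 1 (by simp) i)
              (ih (s - 1) (by linarith) (by linarith) i)
          _ = (m + 1) * K₀ := by ring
  have hneg : ∀ s i, N (-s) i = N s i := by
    intro s i
    change _ = eLpNorm (fun ω => G s ω i) 2 P
    rw [← hS.eLpNorm_increment (-s) s i, ← eLpNorm_neg]
    refine eLpNorm_congr_ae ?_
    filter_upwards [hS.zero] with ω hω
    simp [hω]
  have habs : ∀ s i, N s i = N |s| i := by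
    intro s i
    rcases abs_choice s with h | h
    · rw [h]
    · rw [h, hneg]
  refine ⟨K₀.toReal, ENNReal.toReal_nonneg, fun s i => ?_⟩
  change N s i ≤ _
  rw [habs]
  calc N |s| i ≤ (⌈|s|⌉₊ : ℕ) * K₀ := hnat _ _ (abs_nonneg s) (Nat.le_ceil _) i
    _ = ENNReal.ofReal ((⌈|s|⌉₊ : ℝ) * K₀.toReal) := by
        rw [ENNReal.ofReal_mul (by positivity), ENNReal.ofReal_toReal hK₀, ENNReal.ofReal_natCast]
    _ ≤ _ := by
        refine ENNReal.ofReal_le_ofReal ?_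
        rw [mul_comm]
        refine mul_le_mul_of_nonneg_left ?_ ENNReal.toReal_nonneg
        linarith [Nat.ceil_lt_add_one (abs_nonneg s)]

theorem memLp_noise (hS : LangevinSystem P Θ G U) (s : ℝ) (i : Fin n) :
    MemLp (fun ω => G s ω i) 2 P := by
  obtain ⟨K, -, hK⟩ := hS.exists_eLpNorm_le
  exact ⟨(hS.aemeasurable_apply s i).aestronglyMeasurable, (hK s i).trans_lt ENNReal.ofReal_lt_top⟩

/-- The second moments of increments are determined by the cross-covariance of the noise. -/
theorem integral_increment_mul_increment_eq (hS : LangevinSystem P Θ G U) (a b c d : ℝ)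
    (i j : Fin n) :
    ∫ ω, (G b ω i - G a ω i) * (G d ω j - G c ω j) ∂P =
      crossMoment P (G b) (G d) i j - crossMoment P (G b) (G c) i j -
        (crossMoment P (G a) (G d) i j - crossMoment P (G a) (G c) i j) := by
  have hI : ∀ x y, Integrable (fun ω => G x ω i * G y ω j) P := fun x y =>
    (hS.memLp_noise x i).integrable_mul (hS.memLp_noise y j)
  simp only [crossMoment, Matrix.of_apply]
  have hI' : ∀ x y z, Integrable (fun ω => G x ω i * G y ω j - G x ω i * G z ω j) P :=
    fun x y z => (hI x y).sub (hI x z)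
  rw [← integral_sub (hI _ _) (hI _ _), ← integral_sub (hI _ _) (hI _ _),
    ← integral_sub (hI' _ _ _) (hI' _ _ _)]
  exact integral_congr_ae (ae_of_all _ fun ω => by ring)

end LangevinSystem

/-! ### Second moments of the stationary solution -/

section MovingAverage

variable {n : ℕ} {Ω : Type u} [MeasurableSpace Ω] {P : Measure Ω}
  {Θ : Matrix (Fin n) (Fin n) ℝ} {G U : ℝ → Ω → Fin n → ℝ}

/-- The integrand of the moving-average representation of the stationary solution at time `s`. -/
def maIntegrand (Θ : Matrix (Fin n) (Fin n) ℝ) (H : ℝ → Ω → Fin n → ℝ) (s : ℝ) (i : Fin n)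
    (r : ℝ) (ω : Ω) : ℝ :=
  (maKernel Θ r *ᵥ (H s ω - H (s + r) ω)) i

theorem maIntegrand_eq_sum {Ω : Type u} (H : ℝ → Ω → Fin n → ℝ) (s : ℝ) (i : Fin n) (r : ℝ) (ω : Ω) :
    maIntegrand Θ H s i r ω = ∑ j, maKernel Θ r i j * (H s ω j - H (s + r) ω j) := rfl

theorem measurable_maIntegrand (hΘ : Θ.PosDef) {H : ℝ → Ω → Fin n → ℝ}
    (hH : Measurable (Function.uncurry H)) (s : ℝ) (i : Fin n) :
    Measurable (Function.uncurry (maIntegrand Θ H s i)) := by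
  have h1 : ∀ j, Measurable fun z : ℝ × Ω => H s z.2 j := fun j =>
    (measurable_pi_apply j).comp (hH.comp (measurable_const.prodMk measurable_snd))
  have h2 : ∀ j, Measurable fun z : ℝ × Ω => H (s + z.1) z.2 j := fun j =>
    (measurable_pi_apply j).comp (hH.comp ((measurable_const.add measurable_fst).prodMk
      measurable_snd))
  have h3 : ∀ j, Measurable fun z : ℝ × Ω => maKernel Θ z.1 i j := fun j =>
    (((continuous_maKernel hΘ).matrix_elem i j).measurable).comp measurable_fst
  change Measurable fun z : ℝ × Ω => ∑ j, maKernel Θ z.1 i j * (H s z.2 j - H (s + z.1) z.2 j)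
  exact Finset.measurable_sum _ fun j _ => (h3 j).mul ((h1 j).sub (h2 j))

/-- A bound on the `L²` norm of the integrand of the moving-average representation. -/
def maBound (Θ : Matrix (Fin n) (Fin n) ℝ) (K : ℝ) (i : Fin n) (r : ℝ) : ℝ≥0∞ :=
  ∑ j, ENNReal.ofReal (|maKernel Θ r i j| * (K * (1 + |r|)))

theorem measurable_maBound (hΘ : Θ.PosDef) (K : ℝ) (i : Fin n) : Measurable (maBound Θ K i) := by
  refine Finset.measurable_sum _ fun j _ => ENNReal.measurable_ofReal.comp ?_
  have := (continuous_maKernel hΘ).matrix_elem i j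
  exact (by fun_prop : Continuous fun r => |maKernel Θ r i j| * (K * (1 + |r|))).measurable

/-- Exponential decay beats linear growth. -/
theorem integrableOn_exp_mul_one_add_abs {c : ℝ} (hc : 0 < c) :
    IntegrableOn (fun r : ℝ => Real.exp (c * r) * (1 + |r|)) (Set.Iic 0) := by
  have hexp : IntegrableOn (fun r : ℝ => (1 + 2 / c) * Real.exp (c / 2 * r)) (Set.Iic 0) :=
    Integrable.const_mul (integrableOn_exp_mul_Iic (half_pos hc) 0) _
  refine hexp.mono' ((by fun_prop : Continuous fun r : ℝ =>
    Real.exp (c * r) * (1 + |r|)).aestronglyMeasurable) ?_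
  refine (ae_restrict_iff' measurableSet_Iic).2 (ae_of_all _ fun r hr => ?_)
  have hr : r ≤ 0 := hr
  rw [Real.norm_of_nonneg (by positivity), abs_of_nonpos hr]
  have h1 : c / 2 * (-r) + 1 ≤ Real.exp (c / 2 * (-r)) := Real.add_one_le_exp _
  have h2 : 1 + -r ≤ (1 + 2 / c) * Real.exp (c / 2 * (-r)) := by
    have h3 : 1 + -r ≤ (1 + 2 / c) * (c / 2 * (-r) + 1) := by
      have : (1 + 2 / c) * (c / 2 * (-r) + 1) = 1 + -r + (c / 2 * (-r) + 2 / c) := by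
        field_simp; ring
      rw [this]
      have : 0 ≤ c / 2 * (-r) := mul_nonneg (by positivity) (by linarith)
      have : 0 < 2 / c := by positivity
      linarith
    exact h3.trans (mul_le_mul_of_nonneg_left h1 (by positivity))
  calc Real.exp (c * r) * (1 + -r)
      ≤ Real.exp (c * r) * ((1 + 2 / c) * Real.exp (c / 2 * (-r))) := by gcongr
    _ = (1 + 2 / c) * (Real.exp (c * r) * Real.exp (c / 2 * (-r))) := by ring
    _ = (1 + 2 / c) * Real.exp (c / 2 * r) := by rw [← Real.exp_add]; congr 2; ring

theorem lintegral_ofReal_lt_top_of_le_exp {c K L : ℝ} (hc : 0 < c) {w : ℝ → ℝ} (hL : 0 ≤ L)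
    (hw : ∀ r ≤ 0, w r ≤ K * Real.exp (c * r)) :
    ∫⁻ r in Set.Iic 0, ENNReal.ofReal (w r * (L * (1 + |r|))) < ∞ := by
  have hI := ((integrableOn_exp_mul_one_add_abs hc).const_mul (K * L)).lintegral_lt_top
  refine lt_of_le_of_lt (setLIntegral_mono' measurableSet_Iic fun r hr => ?_) hI
  refine ENNReal.ofReal_le_ofReal ?_
  calc w r * (L * (1 + |r|)) ≤ K * Real.exp (c * r) * (L * (1 + |r|)) :=
        mul_le_mul_of_nonneg_right (hw r hr) (by positivity)
    _ = _ := by ring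

theorem lintegral_maBound_lt_top (hΘ : Θ.PosDef) {K : ℝ} (hK : 0 ≤ K) (i : Fin n) :
    ∫⁻ r in Set.Iic 0, maBound Θ K i r < ∞ := by
  obtain ⟨K', c, hc, hle⟩ := exists_maKernel_le hΘ
  unfold maBound
  rw [lintegral_finsetSum']
  · exact ENNReal.sum_lt_top.2 fun j _ =>
      lintegral_ofReal_lt_top_of_le_exp hc hK fun r hr => hle r hr i j
  · intro j _
    have := (continuous_maKernel hΘ).matrix_elem i j
    exact (ENNReal.measurable_ofReal.comp
      (by fun_prop : Continuous fun r => |maKernel Θ r i j| * (K * (1 + |r|))).measurable).aemeasurable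

namespace LangevinSystem

/-- The moving-average representation of the stationary solution, in terms of a jointly measurable
version of the noise. -/
theorem exists_version [IsProbabilityMeasure P] (hS : LangevinSystem P Θ G U) :
    ∃ (H : ℝ → Ω → Fin n → ℝ) (K : ℝ), Measurable (Function.uncurry H) ∧ 0 ≤ K ∧
      (∀ᵐ ω ∂P, ∀ s, H s ω = G s ω) ∧
      (∀ s i r, eLpNorm (maIntegrand Θ H s i r) 2 P ≤ maBound Θ K i r) ∧
      ∀ᵐ ω ∂P, ∀ s i, U s ω i = ∫ r in Set.Iic 0, maIntegrand Θ H s i r ω := by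
  obtain ⟨K, hK0, hK⟩ := hS.exists_eLpNorm_le
  obtain ⟨H, hH, hHc, hHG⟩ := exists_continuous_version hS.aemeasurable hS.continuous
  have hHs : ∀ s j, Measurable fun ω => H s ω j := fun s j =>
    (measurable_pi_apply j).comp (hH.comp measurable_prodMk_left)
  refine ⟨H, K, hH, hK0, hHG, fun s i r => ?_, ?_⟩
  · have h1 : maIntegrand Θ H s i r =
        ∑ j, fun ω => maKernel Θ r i j * (H s ω j - H (s + r) ω j) := by
      ext ω; rw [maIntegrand_eq_sum, Finset.sum_apply]
    rw [h1]
    have h3 : ∀ j, Measurable fun ω => maKernel Θ r i j * (H s ω j - H (s + r) ω j) := fun j =>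
      ((hHs s j).sub (hHs (s + r) j)).const_mul _
    refine (eLpNorm_sum_le (fun j _ => (h3 j).aestronglyMeasurable) (by norm_num)).trans
      (Finset.sum_le_sum fun j _ => ?_)
    have h2 : (fun ω => maKernel Θ r i j * (H s ω j - H (s + r) ω j)) =
        maKernel Θ r i j • fun ω => H s ω j - H (s + r) ω j := rfl
    rw [h2, eLpNorm_const_smul, ENNReal.ofReal_mul (abs_nonneg _), ← Real.enorm_eq_ofReal_abs]
    gcongr
    refine le_trans (le_of_eq ?_) (hK r j)
    rw [← hS.eLpNorm_increment s r j, ← eLpNorm_neg]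
    refine eLpNorm_congr_ae ?_
    filter_upwards [hHG] with ω hω
    simp [hω, add_comm]
  · -- It suffices to integrate against the weights `e^{r/(m+1)}`, which are countably many.
    have hint : ∀ᵐ ω ∂P, ∀ (m : ℕ) (j : Fin n),
        IntegrableOn (fun r => Real.exp (1 / ((m : ℝ) + 1) * r) * H r ω j) (Set.Iic 0) := by
      refine ae_all_iff.2 fun m => ae_all_iff.2 fun j => ?_
      have hcm : 0 < 1 / ((m : ℝ) + 1) := by positivity
      have hmeas : Measurable (Function.uncurry fun r ω =>
          Real.exp (1 / ((m : ℝ) + 1) * r) * H r ω j) := by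
        have h1 : Measurable fun z : ℝ × Ω => H z.1 z.2 j := (measurable_pi_apply j).comp hH
        have h2 : Measurable fun z : ℝ × Ω => Real.exp (1 / ((m : ℝ) + 1) * z.1) := by fun_prop
        exact h2.mul h1
      have h := integrable_uncurry_of_eLpNorm_le (P := P) (μ := volume.restrict (Set.Iic 0)) hmeas
        (a := fun r => ENNReal.ofReal (Real.exp (1 / ((m : ℝ) + 1) * r) * (K * (1 + |r|)))) ?_
        (lintegral_ofReal_lt_top_of_le_exp (K := 1) hcm hK0 fun r _ => by rw [one_mul])
      · exact h.prod_left_ae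
      · intro r
        have h2 : (fun ω => Real.exp (1 / ((m : ℝ) + 1) * r) * H r ω j) =
          Real.exp (1 / ((m : ℝ) + 1) * r) • fun ω => H r ω j := rfl
        rw [h2, eLpNorm_const_smul, ENNReal.ofReal_mul (Real.exp_pos _).le,
          ← Real.enorm_of_nonneg (Real.exp_pos _).le]
        gcongr
        refine le_trans (le_of_eq (eLpNorm_congr_ae ?_)) (hK r j)
        filter_upwards [hHG] with ω hω
        rw [hω]
    filter_upwards [hint, hHG, hS.solution_continuous, hS.solution, hS.initial]
      with ω hint hHG hUc hsol hini s i
    have hHG' : (fun s => G s ω) = fun s => H s ω := funext fun s => (hHG s).symm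
    rw [hHG'] at hini
    simp_rw [← hHG] at hsol
    refine langevin_eq_integral hS.posDef (hHc ω) hUc hsol (fun c hc j => ?_) hini s i
    obtain ⟨m, hm⟩ := exists_nat_one_div_lt hc
    have hcont : Continuous fun r => H r ω j := (continuous_apply j).comp (hHc ω)
    refine Integrable.mono (hint m j) (by fun_prop : Continuous fun r =>
      Real.exp (c * r) * H r ω j).aestronglyMeasurable ?_
    refine (ae_restrict_iff' measurableSet_Iic).2 (ae_of_all _ fun r hr => ?_)
    rw [norm_mul, norm_mul, Real.norm_of_nonneg (Real.exp_pos _).le,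
      Real.norm_of_nonneg (Real.exp_pos _).le]
    gcongr ?_ * _
    exact Real.exp_le_exp.2 (mul_le_mul_of_nonpos_right hm.le hr)

variable [IsProbabilityMeasure P]

theorem memLp_solution (hS : LangevinSystem P Θ G U) (s : ℝ) (i : Fin n) :
    MemLp (fun ω => U s ω i) 2 P := by
  obtain ⟨H, K, hH, hK0, -, hb, hU⟩ := hS.exists_version
  refine (memLp_two_integral (measurable_maIntegrand hS.posDef hH s i)
    (measurable_maBound hS.posDef K i) (hb s i)
    (lintegral_maBound_lt_top hS.posDef hK0 i)).ae_eq ?_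
  filter_upwards [hU] with ω hω
  exact (hω s i).symm

theorem integral_solution (hS : LangevinSystem P Θ G U) (s : ℝ) (i : Fin n) :
    ∫ ω, U s ω i ∂P = 0 := by
  obtain ⟨H, K, hH, hK0, hHG, hb, hU⟩ := hS.exists_version
  have h := (integral_integral_mul (μ := volume.restrict (Set.Iic 0)) (V := fun _ => (1 : ℝ))
    (measurable_maIntegrand hS.posDef hH s i) measurable_const (memLp_const 1)
    (measurable_maBound hS.posDef K i) (hb s i) (lintegral_maBound_lt_top hS.posDef hK0 i)).2
  simp only [mul_one] at h
  have h0 : ∀ r, ∫ ω, maIntegrand Θ H s i r ω ∂P = 0 := by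
    intro r
    have h1 : ∫ ω, maIntegrand Θ H s i r ω ∂P =
        ∫ ω, ∑ j, maKernel Θ r i j * (G s ω j - G (s + r) ω j) ∂P := by
      refine integral_congr_ae ?_
      filter_upwards [hHG] with ω hω
      rw [maIntegrand_eq_sum]; simp only [hω]
    have hI : ∀ x j, Integrable (fun ω => G x ω j) P := fun x j =>
      (hS.memLp_noise x j).integrable (by norm_num)
    have hI' : ∀ j, Integrable (fun ω => maKernel Θ r i j * (G s ω j - G (s + r) ω j)) P :=
      fun j => ((hI s j).sub (hI (s + r) j)).const_mul _
    rw [h1, integral_finsetSum _ fun j _ => hI' j]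
    refine Finset.sum_eq_zero fun j _ => ?_
    rw [integral_const_mul, integral_sub (hI _ _) (hI _ _), hS.centred, hS.centred]
    simp
  simp only [h0, integral_zero] at h
  rw [← h]
  refine integral_congr_ae ?_
  filter_upwards [hU] with ω hω
  exact hω s i

/-- The second moments of the stationary solution in terms of those of the increments of the
noise. -/
theorem integral_solution_mul_solution (hS : LangevinSystem P Θ G U) (s u : ℝ) (i j : Fin n) :
    ∫ ω, U s ω i * U u ω j ∂P = ∫ r in Set.Iic (0 : ℝ), ∫ q in Set.Iic (0 : ℝ),
      ∑ k, ∑ l, maKernel Θ r i k * maKernel Θ q j l *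
        ∫ ω, (G s ω k - G (s + r) ω k) * (G u ω l - G (u + q) ω l) ∂P := by
  obtain ⟨H, K, hH, hK0, hHG, hb, hU⟩ := hS.exists_version
  have h := integral_integral_mul_integral (P := P) (measurable_maIntegrand hS.posDef hH s i)
    (measurable_maIntegrand hS.posDef hH u j)
    (measurable_maBound hS.posDef K i) (measurable_maBound hS.posDef K j) (hb s i) (hb u j)
    (lintegral_maBound_lt_top hS.posDef hK0 i) (lintegral_maBound_lt_top hS.posDef hK0 j)
  have h1 : ∫ ω, U s ω i * U u ω j ∂P = ∫ ω, (∫ r in Set.Iic 0, maIntegrand Θ H s i r ω) *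
      (∫ r in Set.Iic 0, maIntegrand Θ H u j r ω) ∂P := by
    refine integral_congr_ae ?_
    filter_upwards [hU] with ω hω
    rw [hω, hω]
  rw [h1, h]
  congr 1; ext r; congr 1; ext q
  have hI : ∀ k l, Integrable
      (fun ω => (G s ω k - G (s + r) ω k) * (G u ω l - G (u + q) ω l)) P := fun k l =>
    ((hS.memLp_noise s k).sub (hS.memLp_noise _ k)).integrable_mul
      ((hS.memLp_noise u l).sub (hS.memLp_noise _ l))
  have h2 : ∫ ω, maIntegrand Θ H s i r ω * maIntegrand Θ H u j q ω ∂P =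
      ∫ ω, ∑ k, ∑ l, maKernel Θ r i k * maKernel Θ q j l *
        ((G s ω k - G (s + r) ω k) * (G u ω l - G (u + q) ω l)) ∂P := by
    refine integral_congr_ae ?_
    filter_upwards [hHG] with ω hω
    rw [maIntegrand_eq_sum, maIntegrand_eq_sum, Finset.sum_mul_sum]
    simp only [hω]
    exact Finset.sum_congr rfl fun k _ => Finset.sum_congr rfl fun l _ => by ring
  rw [h2, integral_finsetSum _ fun k _ => integrable_finsetSum _ fun l _ => (hI k l).const_mul _]
  refine Finset.sum_congr rfl fun k _ => ?_
  rw [integral_finsetSum _ fun l _ => (hI k l).const_mul _]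
  exact Finset.sum_congr rfl fun l _ => integral_const_mul _ _

/-- The solution is stationary to second order. -/
theorem integral_solution_mul_solution_add (hS : LangevinSystem P Θ G U) (h s u : ℝ)
    (i j : Fin n) :
    ∫ ω, U (s + h) ω i * U (u + h) ω j ∂P = ∫ ω, U s ω i * U u ω j ∂P := by
  rw [hS.integral_solution_mul_solution, hS.integral_solution_mul_solution]
  congr 1; ext r; congr 1; ext q
  refine Finset.sum_congr rfl fun k _ => Finset.sum_congr rfl fun l _ => ?_
  rw [← hS.integral_increment_mul_increment h (s + r) s (u + q) u, add_right_comm s h r,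
    add_right_comm u h q]

/-- The cross-covariance of the solution at times `s` and `u` depends on `s - u` only. -/
theorem integral_solution_mul_solution_eq (hS : LangevinSystem P Θ G U) (s u : ℝ) (i j : Fin n) :
    ∫ ω, U s ω i * U u ω j ∂P = crossCov P U (s - u) i j := by
  have := hS.integral_solution_mul_solution_add u (s - u) 0 i j
  simpa [crossCov, crossMoment] using this

/-- The cross-covariance satisfies `γ(-s) = γ(s)ᵀ`. -/
theorem crossCov_neg (hS : LangevinSystem P Θ G U) (s : ℝ) :
    crossCov P U (-s) = (crossCov P U s)ᵀ := by
  ext i j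
  have h1 := hS.integral_solution_mul_solution_eq 0 s i j
  have h2 := hS.integral_solution_mul_solution_eq s 0 j i
  rw [zero_sub] at h1
  rw [sub_zero] at h2
  rw [Matrix.transpose_apply, ← h1, ← h2]
  simp_rw [mul_comm]

/-- The cross-covariance of the solution is determined by that of the noise. -/
theorem crossCov_eq_of_crossMoment_eq {Ω₂ : Type v} [MeasurableSpace Ω₂] {P₂ : Measure Ω₂}
    [IsProbabilityMeasure P₂] {G₂ U₂ : ℝ → Ω₂ → Fin n → ℝ} (hS : LangevinSystem P Θ G U)
    (hS₂ : LangevinSystem P₂ Θ G₂ U₂)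
    (h : ∀ a b, crossMoment P₂ (G₂ a) (G₂ b) = crossMoment P (G a) (G b)) :
    crossCov P₂ U₂ = crossCov P U := by
  ext s i j
  simp only [crossCov, crossMoment, Matrix.of_apply]
  rw [hS.integral_solution_mul_solution, hS₂.integral_solution_mul_solution]
  simp only [integral_increment_mul_increment_eq hS, integral_increment_mul_increment_eq hS₂, h]

end LangevinSystem

end MovingAverage

/-! ### The Riccati equation -/

theorem coefB_transpose {n : ℕ} {t : ℝ} (g : ℝ → Matrix (Fin n) (Fin n) ℝ) :
    (coefB t g)ᵀ = -coefB t g := by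
  ext i j
  simp only [coefB, Matrix.transpose_apply, Matrix.neg_apply, Matrix.of_apply]
  rw [← intervalIntegral.integral_neg]
  simp

namespace LangevinSystem

variable {n : ℕ} {Ω : Type u} [MeasurableSpace Ω] {P : Measure Ω} [IsProbabilityMeasure P]
  {Θ : Matrix (Fin n) (Fin n) ℝ} {G U : ℝ → Ω → Fin n → ℝ}

theorem eLpNorm_solution (hS : LangevinSystem P Θ G U) (s : ℝ) (i : Fin n) :
    eLpNorm (fun ω => U s ω i) 2 P = eLpNorm (fun ω => U 0 ω i) 2 P := by
  have h := hS.integral_solution_mul_solution_add s 0 0 i i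
  rw [zero_add] at h
  rw [(hS.memLp_solution s i).eLpNorm_eq_integral_rpow_norm (by norm_num) (by norm_num),
    (hS.memLp_solution 0 i).eLpNorm_eq_integral_rpow_norm (by norm_num) (by norm_num)]
  simp only [ENNReal.toReal_ofNat, Real.rpow_ofNat, Real.norm_eq_abs, sq, abs_mul_abs_self,
    h]

/-- The time integral of the solution is in `L²`, and its moments with other random variables can be
computed under the integral. -/
theorem memLp_integral_solution (hS : LangevinSystem P Θ G U) {t : ℝ} (ht : 0 ≤ t) (i : Fin n) :
    MemLp (fun ω => ∫ s in (0 : ℝ)..t, U s ω i) 2 P ∧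
      ∀ V : Ω → ℝ, MemLp V 2 P →
        IntervalIntegrable (fun s => ∫ ω, U s ω i * V ω ∂P) volume 0 t ∧
        ∫ ω, (∫ s in (0 : ℝ)..t, U s ω i) * V ω ∂P =
          ∫ s in (0 : ℝ)..t, ∫ ω, U s ω i * V ω ∂P := by
  have hUm : ∀ s, AEMeasurable (U s) P := fun s =>
    aemeasurable_pi_lambda _ fun j => (hS.memLp_solution s j).1.aemeasurable
  obtain ⟨H, hH, -, hHU⟩ := exists_continuous_version hUm hS.solution_continuous
  have hm : Measurable (Function.uncurry fun r ω => H r ω i) := (measurable_pi_apply i).comp hH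
  have hb : ∀ r, eLpNorm (fun ω => H r ω i) 2 P ≤ eLpNorm (fun ω => U 0 ω i) 2 P := by
    intro r
    rw [← hS.eLpNorm_solution r i]
    refine le_of_eq (eLpNorm_congr_ae ?_)
    filter_upwards [hHU] with ω hω
    rw [hω]
  have hfin : ∫⁻ _ in Set.Ioc 0 t, eLpNorm (fun ω => U 0 ω i) 2 P < ∞ := by
    rw [setLIntegral_const]
    exact ENNReal.mul_lt_top (hS.memLp_solution 0 i).2 (by simp)
  simp only [intervalIntegral.integral_of_le ht, intervalIntegrable_iff_integrableOn_Ioc_of_le ht]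
  constructor
  · refine (memLp_two_integral hm measurable_const hb hfin).ae_eq ?_
    filter_upwards [hHU] with ω hω
    simp only [hω]
  · intro V hV
    have hVm : V =ᵐ[P] hV.1.mk V := hV.1.ae_eq_mk
    have h := integral_integral_mul (μ := volume.restrict (Set.Ioc 0 t)) hm
      hV.1.stronglyMeasurable_mk.measurable (hV.ae_eq hVm) measurable_const hb hfin
    have h1 : ∀ s, ∫ ω, H s ω i * hV.1.mk V ω ∂P = ∫ ω, U s ω i * V ω ∂P := by
      intro s
      refine integral_congr_ae ?_
      filter_upwards [hHU, hVm] with ω hω hω'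
      rw [hω, hω']
    have h2 : ∫ ω, (∫ s in Set.Ioc 0 t, H s ω i) * hV.1.mk V ω ∂P =
        ∫ ω, (∫ s in Set.Ioc 0 t, U s ω i) * V ω ∂P := by
      refine integral_congr_ae ?_
      filter_upwards [hHU, hVm] with ω hω hω'
      simp only [hω, hω']
    simp only [h1, h2] at h
    exact h

theorem intervalIntegrable_crossCov (hS : LangevinSystem P Θ G U) {t : ℝ} (ht : 0 ≤ t)
    (i j : Fin n) : IntervalIntegrable (fun s => crossCov P U s i j) volume 0 t :=
  ((hS.memLp_integral_solution ht i).2 _ (hS.memLp_solution 0 j)).1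

theorem crossCov_sub_apply_comm (hS : LangevinSystem P Θ G U) (s u : ℝ) (i j : Fin n) :
    crossCov P U (s - u) i j = crossCov P U (u - s) j i := by
  rw [← neg_sub u s, hS.crossCov_neg, Matrix.transpose_apply]

theorem reflect_crossCov (hS : LangevinSystem P Θ G U) :
    reflect (crossCov P U) = crossCov P U := by
  ext1 s
  rw [reflect, hS.crossCov_neg, Matrix.transpose_transpose, ite_self]

theorem integral_integral_solution_mul (hS : LangevinSystem P Θ G U) {t : ℝ} (ht : 0 ≤ t) (s : ℝ)
    (i j : Fin n) :
    ∫ ω, (∫ u in (0 : ℝ)..t, U u ω i) * U s ω j ∂P =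
      ∫ u in (0 : ℝ)..t, crossCov P U (s - u) j i := by
  rw [((hS.memLp_integral_solution ht i).2 _ (hS.memLp_solution s j)).2]
  refine intervalIntegral.integral_congr fun u _ => ?_
  rw [hS.integral_solution_mul_solution_eq, hS.crossCov_sub_apply_comm]

/-- `C` is the second moment matrix of the time integral of the solution. -/
theorem integral_integral_solution_mul_integral_solution (hS : LangevinSystem P Θ G U) {t : ℝ}
    (ht : 0 ≤ t) (i j : Fin n) :
    ∫ ω, (∫ u in (0 : ℝ)..t, U u ω i) * (∫ u in (0 : ℝ)..t, U u ω j) ∂P =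
      coefC t (crossCov P U) i j := by
  rw [((hS.memLp_integral_solution ht i).2 _ (hS.memLp_integral_solution ht j).1).2, coefC,
    Matrix.of_apply]
  refine intervalIntegral.integral_congr fun s _ => ?_
  rw [← hS.integral_integral_solution_mul ht]
  simp_rw [mul_comm]

/-- `B` consists of the mixed moments of the increment and of the time integral of the
solution. -/
theorem integral_integral_solution_mul_increment (hS : LangevinSystem P Θ G U) {t : ℝ}
    (ht : 0 ≤ t) (i j : Fin n) :
    ∫ ω, (∫ u in (0 : ℝ)..t, U u ω j) * (U t ω i - U 0 ω i) ∂P =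
      coefB t (crossCov P U) i j := by
  have hI : ∀ s, Integrable (fun ω => (∫ u in (0 : ℝ)..t, U u ω j) * U s ω i) P := fun s =>
    (hS.memLp_integral_solution ht j).1.integrable_mul (hS.memLp_solution s i)
  simp_rw [mul_sub]
  rw [integral_sub (hI t) (hI 0), hS.integral_integral_solution_mul ht,
    hS.integral_integral_solution_mul ht, coefB, Matrix.of_apply,
    intervalIntegral.integral_sub (hS.intervalIntegrable_crossCov ht i j)
      (hS.intervalIntegrable_crossCov ht j i)]
  congr 1
  · rw [intervalIntegral.integral_comp_sub_left (fun s => crossCov P U s i j) t]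
    simp
  · refine intervalIntegral.integral_congr fun u _ => ?_
    rw [hS.crossCov_sub_apply_comm, sub_zero]

theorem memLp_increment (hS : LangevinSystem P Θ G U) (t : ℝ) (i : Fin n) :
    MemLp (fun ω => U t ω i - U 0 ω i) 2 P :=
  (hS.memLp_solution t i).sub (hS.memLp_solution 0 i)

theorem covMatrix_increment_apply (hS : LangevinSystem P Θ G U) (t : ℝ) (i j : Fin n) :
    covMatrix P (fun ω => U t ω - U 0 ω) i j =
      ∫ ω, (U t ω i - U 0 ω i) * (U t ω j - U 0 ω j) ∂P := by
  have hU : ∀ s k, Integrable (fun ω => U s ω k) P := fun s k =>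
    (hS.memLp_solution s k).integrable (by norm_num)
  rw [covMatrix, Matrix.of_apply]
  simp only [Pi.sub_apply]
  rw [covariance_eq_sub (hS.memLp_increment t i) (hS.memLp_increment t j),
    integral_sub (hU t i) (hU 0 i), hS.integral_solution, hS.integral_solution]
  simp

/-- The covariance matrix of the increment of the stationary solution. -/
theorem covMatrix_increment (hS : LangevinSystem P Θ G U) (t : ℝ) :
    covMatrix P (fun ω => U t ω - U 0 ω) =
      (2 : ℝ) • crossCov P U 0 - crossCov P U t - (crossCov P U t)ᵀ := by
  ext i j
  have hI : ∀ x y k l, Integrable (fun ω => U x ω k * U y ω l) P := fun x y k l =>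
    (hS.memLp_solution x k).integrable_mul (hS.memLp_solution y l)
  have h1 : ∫ ω, (U t ω i - U 0 ω i) * (U t ω j - U 0 ω j) ∂P =
      (∫ ω, U t ω i * U t ω j ∂P - ∫ ω, U t ω i * U 0 ω j ∂P) -
        (∫ ω, U 0 ω i * U t ω j ∂P - ∫ ω, U 0 ω i * U 0 ω j ∂P) := by
    have hI' : ∀ x, Integrable (fun ω => U x ω i * U t ω j - U x ω i * U 0 ω j) P :=
      fun x => (hI _ _ _ _).sub (hI _ _ _ _)
    rw [← integral_sub (hI _ _ _ _) (hI _ _ _ _), ← integral_sub (hI _ _ _ _) (hI _ _ _ _),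
      ← integral_sub (hI' _) (hI' _)]
    exact integral_congr_ae (ae_of_all _ fun ω => by ring)
  rw [hS.covMatrix_increment_apply, h1]
  simp only [hS.integral_solution_mul_solution_eq, Matrix.sub_apply, Matrix.smul_apply,
    Matrix.transpose_apply, sub_self, sub_zero, smul_eq_mul, hS.crossCov_sub_apply_comm 0 t]
  ring

/-- The covariance matrix of the noise, read off from `G_t = (U_t - U_0) + Θ ∫_0^t U_s ds`. -/
theorem covMatrix_noise (hS : LangevinSystem P Θ G U) {t : ℝ} (ht : 0 ≤ t) :
    covMatrix P (G t) = covMatrix P (fun ω => U t ω - U 0 ω) +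
      coefB t (crossCov P U) * Θᵀ + Θ * (coefB t (crossCov P U))ᵀ +
        Θ * coefC t (crossCov P U) * Θᵀ := by
  ext i j
  set A : Fin n → Ω → ℝ := fun i ω => U t ω i - U 0 ω i with hA
  set J : Fin n → Ω → ℝ := fun i ω => ∫ s in (0 : ℝ)..t, U s ω i with hJ
  have hA2 : ∀ i, MemLp (A i) 2 P := hS.memLp_increment t
  have hJ2 : ∀ i, MemLp (J i) 2 P := fun i => (hS.memLp_integral_solution ht i).1
  have hG : ∀ᵐ ω ∂P, ∀ i, G t ω i = A i ω + ∑ k, Θ i k * J k ω := by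
    filter_upwards [hS.zero, hS.solution, hS.solution_continuous] with ω h0 h hc i
    have h1 := congrFun (h 0 t ht) i
    have h2 : ∀ k, (∫ s in (0 : ℝ)..t, U s ω) k = J k ω := fun k =>
      ((ContinuousLinearMap.proj (R := ℝ) (φ := fun _ : Fin n => ℝ) k).intervalIntegral_comp_comm
        (hc.intervalIntegrable 0 t)).symm
    simp only [Pi.sub_apply, Pi.add_apply, Pi.neg_apply, Matrix.mulVec, dotProduct, h0,
      Pi.zero_apply, h2] at h1
    simp only [hA]
    linarith
  have hcov : covMatrix P (G t) i j = ∫ ω, G t ω i * G t ω j ∂P := by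
    rw [covMatrix, Matrix.of_apply, covariance_eq_sub (hS.memLp_noise t i) (hS.memLp_noise t j),
      hS.centred, hS.centred]
    simp
  have hexp : ∫ ω, G t ω i * G t ω j ∂P = ∫ ω, (A i ω * A j ω + ∑ k, Θ j k * (J k ω * A i ω)) +
      (∑ k, Θ i k * (J k ω * A j ω) + ∑ k, ∑ l, Θ i k * Θ j l * (J k ω * J l ω)) ∂P := by
    refine integral_congr_ae ?_
    filter_upwards [hG] with ω hω
    rw [hω, hω, add_mul, mul_add, mul_add, Finset.sum_mul_sum, Finset.mul_sum, Finset.sum_mul]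
    congr 2
    · exact Finset.sum_congr rfl fun k _ => by ring
    · exact Finset.sum_congr rfl fun k _ => by ring
    · exact Finset.sum_congr rfl fun k _ => Finset.sum_congr rfl fun l _ => by ring
  have hi1 : Integrable (fun ω => A i ω * A j ω) P := (hA2 i).integrable_mul (hA2 j)
  have hi2 : ∀ (a : Fin n → ℝ) (m k : Fin n), Integrable (fun ω => a k * (J k ω * A m ω)) P :=
    fun a m k => ((hJ2 k).integrable_mul (hA2 m)).const_mul _
  have hi3 : ∀ k l, Integrable (fun ω => Θ i k * Θ j l * (J k ω * J l ω)) P :=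
    fun k l => ((hJ2 k).integrable_mul (hJ2 l)).const_mul _
  have hs2 : ∀ (a : Fin n → ℝ) (m : Fin n), Integrable (fun ω => ∑ k, a k * (J k ω * A m ω)) P :=
    fun a m => integrable_finsetSum _ fun k _ => hi2 a m k
  have hs3 : Integrable (fun ω => ∑ k, ∑ l, Θ i k * Θ j l * (J k ω * J l ω)) P :=
    integrable_finsetSum _ fun k _ => integrable_finsetSum _ fun l _ => hi3 k l
  have hJA : ∀ k m, ∫ ω, J k ω * A m ω ∂P = coefB t (crossCov P U) m k := fun k m =>
    hS.integral_integral_solution_mul_increment ht m k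
  have hJJ : ∀ k l, ∫ ω, J k ω * J l ω ∂P = coefC t (crossCov P U) k l := fun k l =>
    hS.integral_integral_solution_mul_integral_solution ht k l
  have hi12 : Integrable (fun ω => A i ω * A j ω + ∑ k, Θ j k * (J k ω * A i ω)) P :=
    hi1.add (hs2 _ _)
  have hi23 : Integrable (fun ω => ∑ k, Θ i k * (J k ω * A j ω) +
      ∑ k, ∑ l, Θ i k * Θ j l * (J k ω * J l ω)) P := (hs2 _ _).add hs3
  rw [hcov, hexp, integral_add hi12 hi23, integral_add hi1 (hs2 _ _),
    integral_add (hs2 _ _) hs3, integral_finsetSum _ fun k _ => hi2 _ _ k,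
    integral_finsetSum _ fun k _ => hi2 _ _ k,
    integral_finsetSum _ fun k _ => integrable_finsetSum _ fun l _ => hi3 k l]
  simp_rw [integral_finsetSum _ fun l _ => hi3 _ l, integral_const_mul, hJA, hJJ]
  rw [Matrix.add_apply, Matrix.add_apply, Matrix.add_apply, hS.covMatrix_increment_apply,
    Matrix.mul_assoc]
  simp only [Matrix.mul_apply, Matrix.transpose_apply, Finset.mul_sum]
  rw [add_assoc, add_assoc, add_assoc]
  congr 2
  · exact Finset.sum_congr rfl fun k _ => by ring
  · congr 1
    exact Finset.sum_congr rfl fun k _ => Finset.sum_congr rfl fun l _ => by ring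

theorem isPSDSolution (hS : LangevinSystem P Θ G U) {t : ℝ} (ht : 0 ≤ t) :
    IsPSDSolution (coefB t (crossCov P U)) (coefC t (crossCov P U)) (coefD P G U t) Θ := by
  refine ⟨hS.posDef.posSemidef, ?_⟩
  have hsymm : Θᵀ = Θ := by
    have := hS.posDef.1
    rwa [Matrix.IsHermitian, Matrix.conjTranspose_eq_transpose_of_trivial] at this
  rw [coefD, hS.covMatrix_noise ht, coefB_transpose, hsymm]
  noncomm_ring

end LangevinSystem

/-! ### Linearity of the coefficients in the cross-covariance -/

/-- Interchanging the order of integration over a triangle. -/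
theorem integral_integral_triangle {t : ℝ} (ht : 0 ≤ t) {h : ℝ → ℝ}
    (hh : IntervalIntegrable h volume 0 t) :
    ∫ s in (0 : ℝ)..t, ∫ r in (0 : ℝ)..s, h r = ∫ r in (0 : ℝ)..t, (t - r) * h r := by
  rw [intervalIntegrable_iff_integrableOn_Ioc_of_le ht] at hh
  let F : ℝ → ℝ → ℝ := fun s r => {z : ℝ × ℝ | z.2 ≤ z.1}.indicator (fun z => h z.2) (s, r)
  have hF : Integrable (Function.uncurry F)
      ((volume.restrict (Set.Ioc 0 t)).prod (volume.restrict (Set.Ioc 0 t))) := by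
    have h1 : Integrable (fun z : ℝ × ℝ => h z.2)
      ((volume.restrict (Set.Ioc 0 t)).prod (volume.restrict (Set.Ioc 0 t))) := hh.comp_snd _
    exact h1.indicator (measurableSet_le measurable_snd measurable_fst)
  have hswap := integral_integral_swap hF
  rw [intervalIntegral.integral_of_le ht, intervalIntegral.integral_of_le ht]
  calc ∫ s in Set.Ioc 0 t, ∫ r in (0 : ℝ)..s, h r
      = ∫ s in Set.Ioc 0 t, ∫ r in Set.Ioc 0 t, F s r := by
        refine setIntegral_congr_fun measurableSet_Ioc fun s hs => ?_
        have : F s = (Set.Iic s).indicator h := by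
          ext r; simp [F, Set.indicator]
        rw [this, setIntegral_indicator measurableSet_Iic, intervalIntegral.integral_of_le hs.1.le,
          Set.Ioc_inter_Iic, min_eq_right hs.2]
    _ = ∫ r in Set.Ioc 0 t, ∫ s in Set.Ioc 0 t, F s r := hswap
    _ = ∫ r in Set.Ioc 0 t, (t - r) * h r := by
        refine setIntegral_congr_fun measurableSet_Ioc fun r hr => ?_
        have : (fun s => F s r) = (Set.Ici r).indicator fun _ => h r := by
          ext s; simp [F, Set.indicator]
        have hset : Set.Ioc 0 t ∩ Set.Ici r = Set.Icc r t := by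
          ext s
          simp only [Set.mem_inter_iff, Set.mem_Ioc, Set.mem_Ici, Set.mem_Icc]
          exact ⟨fun h => ⟨h.2, h.1.2⟩, fun h => ⟨⟨hr.1.trans_le h.1, h.2⟩, h.1⟩⟩
        rw [this, setIntegral_indicator measurableSet_Ici, hset, setIntegral_const]
        simp [Real.volume_real_Icc_of_le hr.2]

theorem integral_integral_sub {t : ℝ} (ht : 0 ≤ t) {f : ℝ → ℝ}
    (hf : IntervalIntegrable f volume 0 t)
    (hf' : IntervalIntegrable (fun r => f (-r)) volume 0 t) :
    ∫ s in (0 : ℝ)..t, ∫ u in (0 : ℝ)..t, f (s - u) =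
      ∫ r in (0 : ℝ)..t, (t - r) * (f r + f (-r)) := by
  have hneg : IntervalIntegrable f volume (-t) 0 := by
    have := (IntervalIntegrable.iff_comp_neg (f := f) (a := -t) (b := 0)).2
      (by simpa using hf'.symm)
    exact this
  have hinner : ∀ s ∈ Set.uIcc 0 t, ∫ u in (0 : ℝ)..t, f (s - u) =
      (∫ r in (0 : ℝ)..s, f r) + ∫ r in (0 : ℝ)..(t - s), f (-r) := by
    intro s hs
    rw [Set.uIcc_of_le ht] at hs
    rw [intervalIntegral.integral_comp_sub_left (fun u => f u) s,
      intervalIntegral.integral_comp_neg (fun u => f u), neg_zero, sub_zero, neg_sub, add_comm]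
    refine (intervalIntegral.integral_add_adjacent_intervals (hneg.mono_set ?_)
      (hf.mono_set ?_)).symm
    · rw [Set.uIcc_of_le (by linarith [hs.2]), Set.uIcc_of_le (by linarith)]
      exact Set.Icc_subset_Icc (by linarith [hs.1]) le_rfl
    · rw [Set.uIcc_of_le hs.1, Set.uIcc_of_le ht]
      exact Set.Icc_subset_Icc le_rfl hs.2
  have hprim : ∀ {h : ℝ → ℝ}, IntervalIntegrable h volume 0 t →
      IntervalIntegrable (fun s => ∫ r in (0 : ℝ)..s, h r) volume 0 t := fun hh =>
    (intervalIntegral.continuousOn_primitive_interval (by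
      rw [Set.uIcc_of_le ht]
      exact (intervalIntegrable_iff_integrableOn_Icc_of_le ht).1 hh)).intervalIntegrable
  have h2 : IntervalIntegrable (fun s => ∫ r in (0 : ℝ)..(t - s), f (-r)) volume 0 t := by
    have := (hprim hf').comp_sub_left t
    simpa using this.symm
  have hmul : ∀ {h : ℝ → ℝ}, IntervalIntegrable h volume 0 t →
      IntervalIntegrable (fun r => (t - r) * h r) volume 0 t := fun hh =>
    hh.continuousOn_mul (by fun_prop)
  rw [intervalIntegral.integral_congr hinner, intervalIntegral.integral_add (hprim hf) h2,
    intervalIntegral.integral_comp_sub_left (fun s => ∫ r in (0 : ℝ)..s, f (-r)) t, sub_self,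
    sub_zero, integral_integral_triangle ht hf, integral_integral_triangle ht hf',
    ← intervalIntegral.integral_add (hmul hf) (hmul hf')]
  simp_rw [mul_add]

variable {n : ℕ}

/-- `C` as a single integral of the cross-covariance. -/
theorem coefC_reflect_apply {t : ℝ} (ht : 0 ≤ t) {g : ℝ → Matrix (Fin n) (Fin n) ℝ}
    (hg : ∀ i j, IntervalIntegrable (fun s => g s i j) volume 0 t) (i j : Fin n) :
    coefC t (reflect g) i j = ∫ s in (0 : ℝ)..t, (t - s) * (g s i j + g s j i) := by
  have h1 : ∀ s ∈ Set.uIoc 0 t, reflect g s i j = g s i j := by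
    intro s hs
    rw [Set.uIoc_of_le ht] at hs
    rw [reflect, if_pos hs.1.le]
  have h2 : ∀ s ∈ Set.uIoc 0 t, reflect g (-s) i j = g s j i := by
    intro s hs
    rw [Set.uIoc_of_le ht] at hs
    rw [reflect, if_neg (by linarith [hs.1]), neg_neg, Matrix.transpose_apply]
  rw [coefC, Matrix.of_apply, integral_integral_sub ht (f := fun s => reflect g s i j)
    ((hg i j).congr fun s hs => (h1 s hs).symm) ((hg j i).congr fun s hs => (h2 s hs).symm)]
  refine intervalIntegral.integral_congr_ae (ae_of_all _ fun s hs => ?_)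
  rw [h1 s hs, h2 s hs]

/-- The errors of the coefficients are linear in the error of the cross-covariance. -/
theorem coef_sub_coef_eq_L1 {t : ℝ} (ht : 0 ≤ t) {g k : ℝ → Matrix (Fin n) (Fin n) ℝ}
    (hg : ∀ i j, IntervalIntegrable (fun s => g s i j) volume 0 t)
    (hk : ∀ i j, IntervalIntegrable (fun s => k s i j) volume 0 t) (V : Matrix (Fin n) (Fin n) ℝ) :
    (Matrix.vec (coefC t (reflect g) - coefC t (reflect k)), Matrix.vec (coefB t g - coefB t k),
      Matrix.vec (estD V t g - estD V t k)) = L1 t fun s => Matrix.vec (g s - k s) := by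
  refine Prod.ext ?_ (Prod.ext ?_ ?_)
  · ext p
    have hI : ∀ {f : ℝ → Matrix (Fin n) (Fin n) ℝ},
        (∀ i j, IntervalIntegrable (fun s => f s i j) volume 0 t) →
        IntervalIntegrable (fun s => (t - s) * (f s p.2 p.1 + f s p.1 p.2)) volume 0 t := fun hf =>
      ((hf _ _).add (hf _ _)).continuousOn_mul (by fun_prop)
    simp only [L1, Matrix.vec, Matrix.sub_apply, Prod.fst_swap, Prod.snd_swap]
    rw [coefC_reflect_apply ht hg, coefC_reflect_apply ht hk,
      ← intervalIntegral.integral_sub (hI hg) (hI hk)]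
    exact intervalIntegral.integral_congr fun s _ => by ring
  · ext p
    simp only [L1, Matrix.vec, Matrix.sub_apply, Prod.fst_swap, Prod.snd_swap, coefB,
      Matrix.of_apply]
    rw [← intervalIntegral.integral_sub ((hg _ _).sub (hg _ _)) ((hk _ _).sub (hk _ _))]
    exact intervalIntegral.integral_congr fun s _ => by ring
  · ext p
    simp only [L1, Matrix.vec, Matrix.sub_apply, Prod.fst_swap, Prod.snd_swap, estD,
      Matrix.smul_apply, Matrix.transpose_apply, smul_eq_mul]
    ring

/-! ### Lyapunov stability and the Sylvester equation -/

section Lyapunov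

variable {ι : Type*} [Fintype ι]

/-- `F` is stable in the sense of Lyapunov: some quadratic form strictly decreases along the flow of
`x' = F x`. -/
def LyapunovStable (F : Matrix ι ι ℝ) : Prop :=
  ∃ M : Matrix ι ι ℝ, M.PosDef ∧ (-(Fᵀ * M + M * F)).PosDef

theorem dotProduct_mulVec_lyapunov {F E : Matrix ι ι ℝ} (hE : Eᵀ = E) (x : ι → ℝ) :
    x ⬝ᵥ ((Fᵀ * E + E * F) *ᵥ x) = 2 * ((E *ᵥ x) ⬝ᵥ (F *ᵥ x)) := by
  rw [Matrix.add_mulVec, dotProduct_add, ← Matrix.mulVec_mulVec, ← Matrix.mulVec_mulVec,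
    Matrix.dotProduct_mulVec x Fᵀ, Matrix.vecMul_transpose, Matrix.dotProduct_mulVec x E,
    ← Matrix.mulVec_transpose, hE, dotProduct_comm (F *ᵥ x)]
  ring

theorem transpose_eq_of_isHermitian {ι : Type*} {M : Matrix ι ι ℝ} (h : M.IsHermitian) : Mᵀ = M := by
  rwa [Matrix.IsHermitian, Matrix.conjTranspose_eq_transpose_of_trivial] at h

theorem isHermitian_of_transpose_eq {ι : Type*} {M : Matrix ι ι ℝ} (h : Mᵀ = M) : M.IsHermitian := by
  rwa [Matrix.IsHermitian, Matrix.conjTranspose_eq_transpose_of_trivial]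

/-- If `xᵀ E x` took a positive value, then the quotient `xᵀ E x / xᵀ M x` would have a maximum
`c > 0` at some `x`; there `E x = c M x`, so that `E` would decrease along the flow as `M` does. -/
theorem dotProduct_mulVec_nonpos_of_lyapunov {F E : Matrix ι ι ℝ} (hF : LyapunovStable F)
    (hE : Eᵀ = E) (h : Fᵀ * E + E * F = 0) (x : ι → ℝ) : x ⬝ᵥ (E *ᵥ x) ≤ 0 := by
  classical
  obtain ⟨M, hM, hQ⟩ := hF
  by_contra! hx
  have hMt := transpose_eq_of_isHermitian hM.1
  have hpos : ∀ y : ι → ℝ, y ≠ 0 → 0 < y ⬝ᵥ (M *ᵥ y) := fun y hy => by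
    simpa using hM.dotProduct_mulVec_pos hy
  have hx0 : x ≠ 0 := by rintro rfl; simp at hx
  let q : (ι → ℝ) → ℝ := fun y => (y ⬝ᵥ (E *ᵥ y)) / (y ⬝ᵥ (M *ᵥ y))
  have hscale : ∀ (a : ℝ) (y : ι → ℝ), a ≠ 0 → q (a • y) = q y := by
    intro a y ha
    simp only [q, Matrix.mulVec_smul, dotProduct_smul, smul_dotProduct, smul_eq_mul]
    rw [mul_div_mul_left _ _ ha, mul_div_mul_left _ _ ha]
  have hsphere : ∀ y : ι → ℝ, y ≠ 0 → ‖y‖⁻¹ • y ∈ Metric.sphere (0 : ι → ℝ) 1 := by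
    intro y hy
    rw [mem_sphere_zero_iff_norm, norm_smul, norm_inv, norm_norm,
      inv_mul_cancel₀ (norm_ne_zero_iff.2 hy)]
  have hne : ∀ y ∈ Metric.sphere (0 : ι → ℝ) 1, y ≠ 0 := by
    rintro y hy rfl
    simp at hy
  have hqc : ContinuousOn q (Metric.sphere 0 1) := by
    refine ContinuousOn.div (by fun_prop) (by fun_prop) fun y hy => (hpos y (hne y hy)).ne'
  obtain ⟨y, hy, hmax⟩ := (isCompact_sphere (0 : ι → ℝ) 1).exists_isMaxOn ⟨_, hsphere x hx0⟩ hqc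
  have hmax' : ∀ z : ι → ℝ, z ≠ 0 → q z ≤ q y := by
    intro z hz
    rw [← hscale ‖z‖⁻¹ z (inv_ne_zero (norm_ne_zero_iff.2 hz))]
    exact hmax (hsphere z hz)
  have hy0 := hne y hy
  have hc : 0 < q y := lt_of_lt_of_le (div_pos hx (hpos x hx0)) (hmax' x hx0)
  have hpsd : (q y • M - E).PosSemidef := by
    refine Matrix.PosSemidef.of_dotProduct_mulVec_nonneg (isHermitian_of_transpose_eq ?_) fun z => ?_
    · rw [Matrix.transpose_sub, Matrix.transpose_smul, hMt, hE]
    · rw [star_trivial, Matrix.sub_mulVec, dotProduct_sub, Matrix.smul_mulVec, dotProduct_smul,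
        smul_eq_mul, sub_nonneg]
      by_cases hz : z = 0
      · simp [hz]
      · exact (div_le_iff₀ (hpos z hz)).1 (hmax' z hz)
  have hker : E *ᵥ y = q y • (M *ᵥ y) := by
    have h1 : (q y • M - E) *ᵥ y = 0 := by
      rw [← hpsd.dotProduct_mulVec_zero_iff, star_trivial, Matrix.sub_mulVec, dotProduct_sub,
        Matrix.smul_mulVec, dotProduct_smul, smul_eq_mul, sub_eq_zero]
      exact div_mul_cancel₀ _ (hpos y hy0).ne'
    rw [Matrix.sub_mulVec, Matrix.smul_mulVec, sub_eq_zero] at h1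
    exact h1.symm
  have h1 := dotProduct_mulVec_lyapunov (F := F) hE y
  have h2 := dotProduct_mulVec_lyapunov (F := F) hMt y
  have h3 : 0 < y ⬝ᵥ (-(Fᵀ * M + M * F) *ᵥ y) := by simpa using hQ.dotProduct_mulVec_pos hy0
  rw [h, hker, Matrix.zero_mulVec, dotProduct_zero, smul_dotProduct, smul_eq_mul] at h1
  rw [Matrix.neg_mulVec, dotProduct_neg, h2] at h3
  nlinarith

theorem eq_zero_of_lyapunov {F E : Matrix ι ι ℝ} (hF : LyapunovStable F) (hE : Eᵀ = E)
    (h : Fᵀ * E + E * F = 0) : E = 0 := by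
  classical
  have h1 := dotProduct_mulVec_nonpos_of_lyapunov hF hE h
  have h2 := dotProduct_mulVec_nonpos_of_lyapunov hF (E := -E) (by rw [Matrix.transpose_neg, hE])
    (by rw [Matrix.mul_neg, Matrix.neg_mul, ← neg_add, h, neg_zero])
  simp only [Matrix.neg_mulVec, dotProduct_neg] at h2
  have hpsd : E.PosSemidef := .of_dotProduct_mulVec_nonneg (isHermitian_of_transpose_eq hE)
    fun x => by rw [star_trivial]; linarith [h2 x]
  ext i j
  have := (hpsd.dotProduct_mulVec_zero_iff (Pi.single j 1)).1
    (by rw [star_trivial]; linarith [h1 (Pi.single j 1), h2 (Pi.single j 1)])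
  simpa using congrFun this i

theorem posDef_fromBlocks_diagonal {κ : Type*} [Fintype κ] {M : Matrix ι ι ℝ} {N : Matrix κ κ ℝ}
    (hM : M.PosDef) (hN : N.PosDef) : (Matrix.fromBlocks M 0 0 N).PosDef := by
  refine .of_dotProduct_mulVec_pos (isHermitian_of_transpose_eq ?_) fun x hx => ?_
  · rw [Matrix.fromBlocks_transpose, transpose_eq_of_isHermitian hM.1,
      transpose_eq_of_isHermitian hN.1, Matrix.transpose_zero, Matrix.transpose_zero]
  · obtain ⟨y, z, rfl⟩ : ∃ y z, x = Sum.elim y z := ⟨x ∘ Sum.inl, x ∘ Sum.inr, by simp⟩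
    have h1 := hM.posSemidef.dotProduct_mulVec_nonneg y
    have h2 := hN.posSemidef.dotProduct_mulVec_nonneg z
    rw [star_trivial] at h1 h2 ⊢
    rw [Matrix.fromBlocks_mulVec, sumElim_dotProduct_sumElim]
    simp only [Sum.elim_comp_inl, Sum.elim_comp_inr, Matrix.zero_mulVec, add_zero, zero_add]
    by_cases hy : y = 0
    · have hz : z ≠ 0 := by
        rintro rfl
        exact hx (by rw [hy]; ext (_ | _) <;> rfl)
      have := hN.dotProduct_mulVec_pos hz
      rw [star_trivial] at this
      linarith
    · have := hM.dotProduct_mulVec_pos hy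
      rw [star_trivial] at this
      linarith

/-- The Sylvester equation `F₁ᵀ X + X F₂ = 0` with stable `F₁`, `F₂` has only the trivial solution.
A symmetric block matrix built from `X` reduces this to the Lyapunov equation. -/
theorem eq_zero_of_sylvester {F₁ F₂ X : Matrix ι ι ℝ} (h₁ : LyapunovStable F₁)
    (h₂ : LyapunovStable F₂) (h : F₁ᵀ * X + X * F₂ = 0) : X = 0 := by
  obtain ⟨M₁, hM₁, hQ₁⟩ := h₁
  obtain ⟨M₂, hM₂, hQ₂⟩ := h₂
  have ht : F₂ᵀ * Xᵀ + Xᵀ * F₁ = 0 := by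
    have := congrArg Matrix.transpose h
    rw [Matrix.transpose_add, Matrix.transpose_mul, Matrix.transpose_mul, Matrix.transpose_transpose,
      Matrix.transpose_zero] at this
    rw [add_comm]; exact this
  have hF : LyapunovStable (Matrix.fromBlocks F₁ 0 0 F₂) := by
    refine ⟨Matrix.fromBlocks M₁ 0 0 M₂, posDef_fromBlocks_diagonal hM₁ hM₂, ?_⟩
    have := posDef_fromBlocks_diagonal hQ₁ hQ₂
    simpa [Matrix.fromBlocks_transpose, Matrix.fromBlocks_multiply, Matrix.fromBlocks_add,
      Matrix.fromBlocks_neg] using this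
  have hE := eq_zero_of_lyapunov hF (E := Matrix.fromBlocks 0 X Xᵀ 0)
    (by simp [Matrix.fromBlocks_transpose])
    (by simp [Matrix.fromBlocks_transpose, Matrix.fromBlocks_multiply, Matrix.fromBlocks_add, h, ht])
  rw [← Matrix.fromBlocks_zero, Matrix.fromBlocks_inj] at hE
  exact hE.2.1

end Lyapunov

/-! ### Uniqueness of the solution of the Riccati equation -/

section Riccati

variable {n : ℕ} {B C D M N : Matrix (Fin n) (Fin n) ℝ}

theorem IsPSDSolution.posDef (h : IsPSDSolution B C D M) (hD : D.PosDef) : M.PosDef := by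
  refine .of_dotProduct_mulVec_pos h.1.1 fun x hx => ?_
  refine lt_of_le_of_ne (h.1.dotProduct_mulVec_nonneg x) fun h0 => ?_
  have hMx : M *ᵥ x = 0 := (h.1.dotProduct_mulVec_zero_iff x).1 h0.symm
  have hxM : x ᵥ* M = 0 := by
    rw [← Matrix.mulVec_transpose, transpose_eq_of_isHermitian h.1.1, hMx]
  have h1 := congrArg (fun A => x ⬝ᵥ (A *ᵥ x)) h.2
  simp only [Matrix.add_mulVec, Matrix.sub_mulVec, ← Matrix.mulVec_mulVec, hMx, Matrix.mulVec_zero,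
    dotProduct_add, dotProduct_zero, Matrix.dotProduct_mulVec x M, hxM,
    zero_dotProduct, Matrix.zero_mulVec, zero_add, sub_zero] at h1
  have h2 := hD.dotProduct_mulVec_pos hx
  rw [star_trivial, h1] at h2
  exact lt_irrefl _ h2

/-- The closed-loop matrix `B - C M` of a positive semidefinite solution `M` is stable: by the
Riccati equation, `M` itself is a Lyapunov function. -/
theorem IsPSDSolution.lyapunovStable (h : IsPSDSolution B C D M) (hC : C.PosDef) (hD : D.PosDef) :
    LyapunovStable (B - C * M) := by
  have hMt := transpose_eq_of_isHermitian h.1.1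
  refine ⟨M, h.posDef hD, ?_⟩
  have h1 : -((B - C * M)ᵀ * M + M * (B - C * M)) = D + M * C * M - (Bᵀ * M + M * B - M * C * M + D)
      := by
    rw [Matrix.transpose_sub, Matrix.transpose_mul, hMt, transpose_eq_of_isHermitian hC.1]
    noncomm_ring
  rw [h1, h.2, sub_zero]
  refine hD.add_posSemidef ?_
  have := hC.posSemidef.mul_mul_conjTranspose_same M
  rwa [h.1.1] at this

theorem IsPSDSolution.unique (hM : IsPSDSolution B C D M) (hN : IsPSDSolution B C D N)
    (hC : C.PosDef) (hD : D.PosDef) : M = N := by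
  refine sub_eq_zero.1 (eq_zero_of_sylvester (hM.lyapunovStable hC hD) (hN.lyapunovStable hC hD) ?_)
  have h1 : (B - C * M)ᵀ * (M - N) + (M - N) * (B - C * N) =
      (Bᵀ * M + M * B - M * C * M + D) - (Bᵀ * N + N * B - N * C * N + D) := by
    rw [Matrix.transpose_sub, Matrix.transpose_mul, transpose_eq_of_isHermitian hM.1.1,
      transpose_eq_of_isHermitian hC.1]
    noncomm_ring
  rw [h1, hM.2, hN.2, sub_zero]

theorem careSolution_eq (h : IsPSDSolution B C D M) (hC : C.PosDef) (hD : D.PosDef) :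
    careSolution B C D = M := by
  have hu : ∃! M, IsPSDSolution B C D M := ⟨M, h, fun N hN => hN.unique h hC hD⟩
  rw [careSolution, dif_pos hu]
  exact hu.choose_spec.1.unique h hC hD

theorem kroneckerSum_mulVec_vec (F X : Matrix (Fin n) (Fin n) ℝ) :
    kroneckerSum Fᵀ Fᵀ *ᵥ Matrix.vec X = Matrix.vec (Fᵀ * X + X * F) := by
  rw [kroneckerSum, Matrix.add_mulVec, Matrix.kronecker_mulVec_vec, Matrix.kronecker_mulVec_vec,
    Matrix.transpose_one, Matrix.mul_one, Matrix.one_mul, Matrix.transpose_transpose,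
    ← Matrix.vec_add]

theorem isUnit_kroneckerSum {F : Matrix (Fin n) (Fin n) ℝ} (hF : LyapunovStable F) :
    IsUnit (kroneckerSum Fᵀ Fᵀ) := by
  refine Matrix.mulVec_injective_iff_isUnit.1
    ((injective_iff_map_eq_zero (kroneckerSum Fᵀ Fᵀ).mulVecLin).2 fun x hx => ?_)
  obtain ⟨X, rfl⟩ := Matrix.vec_bijective.2 x
  rw [Matrix.mulVecLin_apply, kroneckerSum_mulVec_vec, Matrix.vec_eq_zero_iff] at hx
  rw [eq_zero_of_sylvester hF hF hx, Matrix.vec_zero]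

end Riccati

/-! ### Measurability of the solution of the Riccati equation -/

theorem measurableSet_fst_image_of_isClosed {Z W : Type*} [MetricSpace Z] [ProperSpace Z]
    [MeasurableSpace Z] [BorelSpace Z] [MetricSpace W] [ProperSpace W] {S : Set (Z × W)} (hS : IsClosed S) :
    MeasurableSet (Prod.fst '' S) := by
  obtain ⟨K, hK, hKS⟩ := (isSigmaCompact_univ.of_isClosed_subset hS (Set.subset_univ S)).image
    continuous_fst
  rw [← hKS]
  exact MeasurableSet.iUnion fun m => (hK m).measurableSet

/-- The unique solution of a closed condition depends measurably on the parameters, where a fixed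
value is assigned to the parameters without a unique solution. -/
theorem measurable_of_isClosed_of_existsUnique {Z W : Type*} [MetricSpace Z] [ProperSpace Z]
    [MeasurableSpace Z] [BorelSpace Z] [MetricSpace W] [ProperSpace W] [MeasurableSpace W]
    [BorelSpace W] {S : Set (Z × W)} (hS : IsClosed S) {f : Z → W}
    {w₀ : W} (h₁ : ∀ z, (∃! w, (z, w) ∈ S) → (z, f z) ∈ S)
    (h₀ : ∀ z, (¬∃! w, (z, w) ∈ S) → f z = w₀) : Measurable f := by
  have hex : ∀ K : Set W, IsClosed K → MeasurableSet {z | ∃ w ∈ K, (z, w) ∈ S} := by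
    intro K hK
    have := measurableSet_fst_image_of_isClosed (hS.inter (hK.preimage continuous_snd))
    convert this using 1
    ext z
    simp [and_comm]
  have htwo : MeasurableSet {z | ∃ w w', w ≠ w' ∧ (z, w) ∈ S ∧ (z, w') ∈ S} := by
    have : {z | ∃ w w', w ≠ w' ∧ (z, w) ∈ S ∧ (z, w') ∈ S} = ⋃ m : ℕ, Prod.fst ''
        {x : Z × W × W | 1 / ((m : ℝ) + 1) ≤ dist x.2.1 x.2.2 ∧ (x.1, x.2.1) ∈ S ∧
          (x.1, x.2.2) ∈ S} := by
      ext z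
      simp only [Set.mem_ofPred_eq, Set.mem_iUnion, Set.mem_image, Prod.exists, exists_and_right,
        exists_eq_right]
      constructor
      · rintro ⟨w, w', hne, hw, hw'⟩
        obtain ⟨m, hm⟩ := exists_nat_one_div_lt (dist_pos.2 hne)
        exact ⟨m, w, w', hm.le, hw, hw'⟩
      · rintro ⟨m, w, w', hm, hw, hw'⟩
        exact ⟨w, w', dist_pos.1 (lt_of_lt_of_le (by positivity) hm), hw, hw'⟩
    rw [this]
    refine MeasurableSet.iUnion fun m => measurableSet_fst_image_of_isClosed ?_
    have hle : IsClosed {x : Z × W × W | 1 / ((m : ℝ) + 1) ≤ dist x.2.1 x.2.2} :=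
      isClosed_le (by fun_prop) (by fun_prop)
    exact hle.inter ((hS.preimage (by fun_prop : Continuous fun x : Z × W × W => (x.1, x.2.1))).inter
      (hS.preimage (by fun_prop : Continuous fun x : Z × W × W => (x.1, x.2.2))))
  have hA : MeasurableSet {z | ∃! w, (z, w) ∈ S} := by
    have : {z | ∃! w, (z, w) ∈ S} = {z | ∃ w ∈ Set.univ, (z, w) ∈ S} \
        {z | ∃ w w', w ≠ w' ∧ (z, w) ∈ S ∧ (z, w') ∈ S} := by
      ext z
      simp only [Set.mem_ofPred_eq, Set.mem_sdiff, Set.mem_univ, true_and]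
      constructor
      · rintro ⟨w, hw, hu⟩
        refine ⟨⟨w, hw⟩, ?_⟩
        rintro ⟨x, y, hne, hx, hy⟩
        exact hne ((hu x hx).trans (hu y hy).symm)
      · rintro ⟨⟨w, hw⟩, hu⟩
        exact ⟨w, hw, fun y hy => by_contra fun hne => hu ⟨y, w, hne, hy, hw⟩⟩
    rw [this]
    exact (hex _ isClosed_univ).diff htwo
  refine measurable_of_isClosed fun K hK => ?_
  have : f ⁻¹' K = ({z | ∃! w, (z, w) ∈ S} ∩ {z | ∃ w ∈ K, (z, w) ∈ S}) ∪
      ({z | ∃! w, (z, w) ∈ S}ᶜ ∩ {_z | w₀ ∈ K}) := by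
    ext z
    by_cases hz : ∃! w, (z, w) ∈ S
    · simp only [Set.mem_preimage, Set.mem_union, Set.mem_inter_iff, Set.mem_ofPred_eq, hz, true_and,
        Set.mem_compl_iff, not_true_eq_false, false_and, or_false]
      constructor
      · exact fun h => ⟨f z, h, h₁ z hz⟩
      · rintro ⟨w, hw, hwS⟩
        rwa [hz.unique (h₁ z hz) hwS]
    · simp [hz, h₀ z hz]
  rw [this]
  exact (hA.inter (hex K hK)).union (hA.compl.inter (MeasurableSet.const _))

/-! ### Differentiability of the solution of the Riccati equation -/

section Implicit

variable {n : ℕ}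

/-- The matrix with the given vectorization. -/
def unvec (x : VecMat n) : Matrix (Fin n) (Fin n) ℝ := Matrix.of fun i j => x (j, i)

@[simp]
theorem unvec_vec (A : Matrix (Fin n) (Fin n) ℝ) : unvec (Matrix.vec A) = A := rfl

@[simp]
theorem vec_unvec (x : VecMat n) : Matrix.vec (unvec x) = x := rfl

theorem continuous_unvec : Continuous (unvec : VecMat n → Matrix (Fin n) (Fin n) ℝ) :=
  continuous_matrix fun i j => continuous_apply (j, i)

/-- Matrix multiplication in terms of vectorized matrices. -/
def vecMulL (n : ℕ) : VecMat n →L[ℝ] VecMat n →L[ℝ] VecMat n :=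
  (LinearMap.mk₂ ℝ (fun x y => Matrix.vec (unvec x * unvec y))
    (fun x x' y => congrArg Matrix.vec (Matrix.add_mul (unvec x) (unvec x') (unvec y)))
    (fun c x y => congrArg Matrix.vec (Matrix.smul_mul c (unvec x) (unvec y)))
    (fun x y y' => congrArg Matrix.vec (Matrix.mul_add (unvec x) (unvec y) (unvec y')))
    (fun c x y => congrArg Matrix.vec
      (Matrix.mul_smul (unvec x) c (unvec y)))).toContinuousBilinearMap

/-- Transposition in terms of vectorized matrices, as a continuous linear map. -/
def transposeVecL (n : ℕ) : VecMat n →L[ℝ] VecMat n := (transposeVec n).toContinuousLinearMap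

theorem transposeVecL_apply (x : VecMat n) : transposeVecL n x = Matrix.vec (unvec x)ᵀ := rfl

/-- The left-hand side of the Riccati equation as a function of the (vectorized) coefficients
`(c, b, d)` and of the (vectorized) unknown. -/
def riccatiMap (z : (VecMat n × VecMat n × VecMat n) × VecMat n) : VecMat n :=
  vecMulL n (transposeVecL n z.1.2.1) z.2 + vecMulL n z.2 z.1.2.1 -
    vecMulL n (vecMulL n z.2 z.1.1) z.2 + z.1.2.2

theorem riccatiMap_apply (c b d m : VecMat n) :
    riccatiMap ((c, b, d), m) = Matrix.vec ((unvec b)ᵀ * unvec m + unvec m * unvec b -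
      unvec m * unvec c * unvec m + unvec d) := rfl

theorem continuous_riccatiMap : Continuous (riccatiMap (n := n)) := by
  unfold riccatiMap
  fun_prop

/-- The total derivative of `riccatiMap`. -/
theorem exists_hasStrictFDerivAt_riccatiMap (c b d m : VecMat n) :
    ∃ F' : ((VecMat n × VecMat n × VecMat n) × VecMat n) →L[ℝ] VecMat n,
      HasStrictFDerivAt riccatiMap F' ((c, b, d), m) ∧
      ∀ c' b' d' m', F' ((c', b', d'), m') = Matrix.vec
        (((unvec b')ᵀ * unvec m + unvec m * unvec b' - unvec m * unvec c' * unvec m + unvec d') +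
          ((unvec b)ᵀ * unvec m' + unvec m' * unvec b - unvec m' * unvec c * unvec m -
            unvec m * unvec c * unvec m')) := by
  let E := (VecMat n × VecMat n × VecMat n) × VecMat n
  let z : E := ((c, b, d), m)
  have hm : HasStrictFDerivAt (fun z : E => z.2) (ContinuousLinearMap.snd ℝ _ _) z :=
    hasStrictFDerivAt_snd
  have hz : HasStrictFDerivAt (fun z : E => z.1) (ContinuousLinearMap.fst ℝ _ _) z :=
    hasStrictFDerivAt_fst
  have hc := hz.fst
  have hb := hz.snd.fst
  have hd := hz.snd.snd
  have hbt := (transposeVecL n).hasStrictFDerivAt.comp z hb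
  have h1 := (vecMulL n).hasStrictFDerivAt_of_bilinear hbt hm
  have h2 := (vecMulL n).hasStrictFDerivAt_of_bilinear hm hb
  have h3 := (vecMulL n).hasStrictFDerivAt_of_bilinear
    ((vecMulL n).hasStrictFDerivAt_of_bilinear hm hc) hm
  refine ⟨_, ((h1.add h2).sub h3).add hd, fun c' b' d' m' => ?_⟩
  change Matrix.vec (((unvec b)ᵀ * unvec m' + (unvec b')ᵀ * unvec m) +
    (unvec m * unvec b' + unvec m' * unvec b) - ((unvec m * unvec c) * unvec m' +
      (unvec m * unvec c' + unvec m' * unvec c) * unvec m) + unvec d') = _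
  rw [Matrix.add_mul]
  congr 1
  abel

/-- The linear map `L₂*` is minus the derivative of the left-hand side of the Riccati equation with
respect to its coefficients. -/
theorem L2star_apply {Θ : Matrix (Fin n) (Fin n) ℝ} (hΘ : Θᵀ = Θ) (c b d : VecMat n) :
    L2star Θ (c, b, d) = -Matrix.vec ((unvec b)ᵀ * Θ + Θ * unvec b - Θ * unvec c * Θ + unvec d) := by
  obtain ⟨c, rfl⟩ := Matrix.vec_bijective.2 c
  obtain ⟨b, rfl⟩ := Matrix.vec_bijective.2 b
  obtain ⟨d, rfl⟩ := Matrix.vec_bijective.2 d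
  have ht : transposeVec n (Matrix.vec b) = Matrix.vec bᵀ := rfl
  simp only [L2star, LinearMap.sub_apply, LinearMap.comp_apply, LinearMap.fst_apply,
    LinearMap.snd_apply, Matrix.mulVecLin_apply, ht, Matrix.kronecker_mulVec_vec, unvec_vec,
    Matrix.transpose_one, Matrix.mul_one, Matrix.one_mul, hΘ, ← Matrix.vec_sub, ← Matrix.vec_neg]
  congr 1
  abel

theorem eventually_posDef {M : Matrix (Fin n) (Fin n) ℝ} (hM : M.PosDef) :
    ∀ᶠ N in 𝓝 M, N.IsSymm → N.PosDef := by
  have hpos : ∀ᶠ N in 𝓝 M, ∀ x ∈ Metric.sphere (0 : Fin n → ℝ) 1, 0 < x ⬝ᵥ (N *ᵥ x) := by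
    refine (isCompact_sphere 0 1).eventually_forall_of_forall_eventually fun x hx => ?_
    have hx0 : x ≠ 0 := by
      rintro rfl
      simp at hx
    have hc : Continuous fun z : Matrix (Fin n) (Fin n) ℝ × (Fin n → ℝ) => z.2 ⬝ᵥ (z.1 *ᵥ z.2) := by
      fun_prop
    refine hc.continuousAt.eventually (lt_mem_nhds ?_)
    simpa using hM.dotProduct_mulVec_pos hx0
  filter_upwards [hpos] with N hN hsymm
  refine .of_dotProduct_mulVec_pos (isHermitian_of_transpose_eq hsymm) fun x hx => ?_
  have hnx : 0 < ‖x‖ := norm_pos_iff.2 hx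
  have := hN (‖x‖⁻¹ • x) (by
    rw [mem_sphere_zero_iff_norm, norm_smul, norm_inv, norm_norm, inv_mul_cancel₀ hnx.ne'])
  rw [Matrix.mulVec_smul, dotProduct_smul, smul_dotProduct, smul_eq_mul, smul_eq_mul] at this
  rw [star_trivial]
  exact pos_of_mul_pos_right (pos_of_mul_pos_right this (by positivity)) (by positivity)

/-- The vectorized solution of the Riccati equation as a function of its vectorized coefficients
`(c, b, d)`. -/
def careVec (z : VecMat n × VecMat n × VecMat n) : VecMat n :=
  Matrix.vec (careSolution (unvec z.2.1) (unvec z.1) (unvec z.2.2))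

theorem isClosed_posSemidef : IsClosed {M : Matrix (Fin n) (Fin n) ℝ | M.PosSemidef} := by
  have : {M : Matrix (Fin n) (Fin n) ℝ | M.PosSemidef} =
      {M | Mᵀ = M} ∩ ⋂ x : Fin n → ℝ, {M | 0 ≤ x ⬝ᵥ (M *ᵥ x)} := by
    ext M
    simp only [Set.mem_inter_iff, Set.mem_iInter, Set.mem_ofPred_eq,
      Matrix.posSemidef_iff_dotProduct_mulVec, star_trivial, Matrix.IsHermitian,
      Matrix.conjTranspose_eq_transpose_of_trivial]
  rw [this]
  exact (isClosed_eq (by fun_prop) continuous_id).inter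
    (isClosed_iInter fun x => isClosed_le continuous_const (by fun_prop))

theorem measurable_careVec : Measurable (careVec (n := n)) := by
  have hiff : ∀ (z : VecMat n × VecMat n × VecMat n) (m : VecMat n),
      IsPSDSolution (unvec z.2.1) (unvec z.1) (unvec z.2.2) (unvec m) ↔
        (unvec m).PosSemidef ∧ riccatiMap (z, m) = 0 := by
    rintro ⟨c, b, d⟩ m
    rw [IsPSDSolution, riccatiMap_apply, Matrix.vec_eq_zero_iff]
  let S : Set ((VecMat n × VecMat n × VecMat n) × VecMat n) :=
    {x | (unvec x.2).PosSemidef ∧ riccatiMap x = 0}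
  have hS : IsClosed S :=
    (isClosed_posSemidef.preimage (continuous_unvec.comp continuous_snd)).inter
      (isClosed_eq continuous_riccatiMap continuous_const)
  have hex : ∀ z, (∃! m, (z, m) ∈ S) ↔
      ∃! M, IsPSDSolution (unvec z.2.1) (unvec z.1) (unvec z.2.2) M := by
    intro z
    constructor
    · rintro ⟨m, hm, hu⟩
      exact ⟨unvec m, (hiff z m).2 hm, fun N hN =>
        congrArg unvec (hu (Matrix.vec N) ((hiff z (Matrix.vec N)).1 hN))⟩
    · rintro ⟨M, hM, hu⟩
      exact ⟨Matrix.vec M, (hiff z (Matrix.vec M)).1 hM, fun m hm =>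
        congrArg Matrix.vec (hu (unvec m) ((hiff z m).2 hm))⟩
  refine measurable_of_isClosed_of_existsUnique hS (w₀ := 0) (fun z hz => ?_) fun z hz => ?_
  · have hz' := (hex z).1 hz
    refine (hiff z _).1 ?_
    rw [careVec, careSolution, dif_pos hz']
    exact hz'.choose_spec.1
  · rw [careVec, careSolution, dif_neg fun h => hz ((hex z).2 h), Matrix.vec_zero]

/-- Near coefficients with positive definite `C` and `D`, and as long as the coefficients `C` and `D`
are symmetric, the solution of the Riccati equation agrees with a function that is differentiable with
the derivative `L₂`. This function is given by the implicit function theorem. -/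
theorem exists_hasFDerivAt_careVec {Θ B C D : Matrix (Fin n) (Fin n) ℝ}
    (h : IsPSDSolution B C D Θ) (hC : C.PosDef) (hD : D.PosDef) :
    ∃ φ : VecMat n × VecMat n × VecMat n → VecMat n,
      HasFDerivAt φ (L2 Θ B C).toContinuousLinearMap
        (Matrix.vec C, Matrix.vec B, Matrix.vec D) ∧
      φ (Matrix.vec C, Matrix.vec B, Matrix.vec D) = Matrix.vec Θ ∧
      ∀ᶠ z in 𝓝 (Matrix.vec C, Matrix.vec B, Matrix.vec D),
        (unvec z.1).IsSymm → (unvec z.2.2).IsSymm → careVec z = φ z := by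
  have hΘt := transpose_eq_of_isHermitian h.1.1
  have hCt := transpose_eq_of_isHermitian hC.1
  have hK := isUnit_kroneckerSum (h.lyapunovStable hC hD)
  set F := B - C * Θ with hF
  set z₀ := (Matrix.vec C, Matrix.vec B, Matrix.vec D) with hz₀
  obtain ⟨R', hR, hR'⟩ := exists_hasStrictFDerivAt_riccatiMap (Matrix.vec C) (Matrix.vec B)
    (Matrix.vec D) (Matrix.vec Θ)
  simp only [unvec_vec] at hR'
  have hinr : ∀ m', (R' ∘L .inr ℝ _ _) m' = kroneckerSum Fᵀ Fᵀ *ᵥ m' := by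
    intro m'
    obtain ⟨M, rfl⟩ := Matrix.vec_bijective.2 m'
    rw [kroneckerSum_mulVec_vec, hF, Matrix.transpose_sub, Matrix.transpose_mul, hΘt, hCt]
    have : (R' ∘L .inr ℝ _ _) (Matrix.vec M) = R' ((0, 0, 0), Matrix.vec M) := rfl
    rw [this, hR']
    have h0 : unvec (0 : VecMat n) = 0 := rfl
    rw [h0, unvec_vec, Matrix.transpose_zero]
    congr 1
    noncomm_ring
  have hinl : ∀ z', (R' ∘L .inl ℝ _ _) z' = -L2star Θ z' := by
    rintro ⟨c, b, d⟩
    have : (R' ∘L .inl ℝ _ _) (c, b, d) = R' ((c, b, d), 0) := rfl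
    rw [this, hR', L2star_apply hΘt, neg_neg]
    have h0 : unvec (0 : VecMat n) = 0 := rfl
    rw [h0]
    congr 1
    noncomm_ring
  let e : VecMat n ≃L[ℝ] VecMat n := ContinuousLinearEquiv.equivOfInverse (R' ∘L .inr ℝ _ _)
    ((kroneckerSum Fᵀ Fᵀ)⁻¹.mulVecLin.toContinuousLinearMap)
    (fun m => by
      rw [hinr]
      change (kroneckerSum Fᵀ Fᵀ)⁻¹ *ᵥ _ = m
      rw [Matrix.mulVec_mulVec, Matrix.nonsing_inv_mul _ ((Matrix.isUnit_iff_isUnit_det _).1 hK),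
        Matrix.one_mulVec])
    (fun m => by
      rw [hinr]
      change _ *ᵥ ((kroneckerSum Fᵀ Fᵀ)⁻¹ *ᵥ m) = m
      rw [Matrix.mulVec_mulVec, Matrix.mul_nonsing_inv _ ((Matrix.isUnit_iff_isUnit_det _).1 hK),
        Matrix.one_mulVec])
  have hinv : (R' ∘L .inr ℝ _ _).IsInvertible := ⟨e, rfl⟩
  have hR0 : riccatiMap (z₀, Matrix.vec Θ) = 0 := by
    rw [hz₀, riccatiMap_apply]
    exact Matrix.vec_eq_zero_iff.2 h.2
  set φ := hR.implicitFunctionOfProdDomain hinv with hφ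
  have hφz : φ z₀ = Matrix.vec Θ :=
    (hR.eventually_apply_eq_iff_implicitFunctionOfProdDomain hinv).self_of_nhds.1 rfl
  have htend : Tendsto φ (𝓝 z₀) (𝓝 (Matrix.vec Θ)) := hR.tendsto_implicitFunctionOfProdDomain hinv
  have hsol := hR.eventually_apply_implicitFunctionOfProdDomain hinv
  have huniq := hR.eventually_apply_eq_iff_implicitFunctionOfProdDomain hinv
  rw [← hφ] at hsol huniq
  refine ⟨φ, ?_, hφz, ?_⟩
  · refine ((hR.hasStrictFDerivAt_implicitFunctionOfProdDomain hinv).hasFDerivAt).congr_fderiv ?_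
    refine ContinuousLinearMap.ext fun z' => ?_
    have hinve : (R' ∘L .inr ℝ _ _).inverse = (e.symm : VecMat n →L[ℝ] VecMat n) :=
      ContinuousLinearMap.inverse_equiv e
    rw [hinve]
    change -(e.symm ((R' ∘L .inl ℝ _ _) z')) = (kroneckerSum Fᵀ Fᵀ)⁻¹ *ᵥ (L2star Θ z')
    rw [hinl, map_neg, neg_neg]
    rfl
  · -- The transpose of a solution is a solution, so that solutions near `Θ` are symmetric.
    have htend' : Tendsto (fun z => (z, transposeVecL n (φ z))) (𝓝 z₀) (𝓝 (z₀, Matrix.vec Θ)) := by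
      have h1 := ((transposeVecL n).continuous.tendsto (Matrix.vec Θ)).comp htend
      rw [transposeVecL_apply, unvec_vec, hΘt] at h1
      exact (tendsto_id (x := 𝓝 z₀)).prodMk_nhds h1
    have hc1 : Tendsto (fun z => unvec (φ z)) (𝓝 z₀) (𝓝 Θ) :=
      (continuous_unvec.tendsto (Matrix.vec Θ)).comp htend
    have hc2 : Tendsto (fun z : VecMat n × VecMat n × VecMat n => unvec z.1) (𝓝 z₀) (𝓝 C) :=
      (continuous_unvec.comp continuous_fst).tendsto z₀
    have hc3 : Tendsto (fun z : VecMat n × VecMat n × VecMat n => unvec z.2.2) (𝓝 z₀) (𝓝 D) :=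
      (continuous_unvec.comp (continuous_snd.comp continuous_snd)).tendsto z₀
    filter_upwards [hsol, htend'.eventually huniq, hc1.eventually (eventually_posDef (h.posDef hD)),
      hc2.eventually (eventually_posDef hC), hc3.eventually (eventually_posDef hD)]
      with z hz hz' hp1 hp2 hp3 hs1 hs3
    have hz0 : (unvec z.2.1)ᵀ * unvec (φ z) + unvec (φ z) * unvec z.2.1 -
        unvec (φ z) * unvec z.1 * unvec (φ z) + unvec z.2.2 = 0 :=
      Matrix.vec_eq_zero_iff.1 (hz.trans hR0)
    have hsymm : (unvec (φ z)).IsSymm := by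
      have h1 : φ z = transposeVecL n (φ z) := by
        refine hz'.1 (Eq.trans ?_ hR0.symm)
        have h2 := congrArg Matrix.transpose hz0
        simp only [Matrix.transpose_add, Matrix.transpose_sub, Matrix.transpose_mul,
          Matrix.transpose_transpose, hs1.eq, hs3.eq, Matrix.transpose_zero] at h2
        refine (riccatiMap_apply z.1 z.2.1 z.2.2 _).trans (Matrix.vec_eq_zero_iff.2
          (Eq.trans ?_ h2))
        rw [transposeVecL_apply, unvec_vec]
        noncomm_ring
      exact (congrArg unvec h1).symm
    rw [careVec, careSolution_eq ⟨(hp1 hsymm).posSemidef, hz0⟩ (hp2 hs1) (hp3 hs3), vec_unvec]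

end Implicit

/-! ### The delta method -/

section DeltaMethod

variable {Ω : Type u} [MeasurableSpace Ω] {P : Measure Ω} [IsProbabilityMeasure P]
  {Ω' : Type v} [MeasurableSpace Ω'] {P' : Measure Ω'} [IsProbabilityMeasure P']
  {E F : Type*} [NormedAddCommGroup E] [MeasurableSpace E] [BorelSpace E]
  [NormedAddCommGroup F] [NormedSpace ℝ F] [MeasurableSpace F] [BorelSpace F]
  {ι : Type*} {L : Filter ι}

/-- A family of random variables that converges in law is asymptotically tight. -/
theorem exists_eventually_measure_norm_ge_lt {Y : ι → Ω → E} {V : Ω' → E}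
    (hY : TendstoInDistribution Y L V (fun _ => P) P') {η : ℝ≥0∞} (hη : 0 < η) :
    ∃ K : ℝ, 0 < K ∧ ∀ᶠ T in L, P {ω | K ≤ ‖Y T ω‖} < η := by
  have hV := hY.aemeasurable_limit
  have hnull : ∀ k : ℕ, NullMeasurableSet {ω | (k : ℝ) + 1 ≤ ‖V ω‖} P' := fun k =>
    nullMeasurableSet_le aemeasurable_const hV.norm
  have hlim : Tendsto (fun k : ℕ => P' {ω | (k : ℝ) + 1 ≤ ‖V ω‖}) atTop (𝓝 0) := by
    have hempty : ⋂ k : ℕ, {ω | (k : ℝ) + 1 ≤ ‖V ω‖} = ∅ := by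
      ext ω
      simp only [Set.mem_iInter, Set.mem_ofPred_eq, Set.mem_empty_iff_false, iff_false, not_forall,
        not_le]
      obtain ⟨k, hk⟩ := exists_nat_gt ‖V ω‖
      exact ⟨k, by linarith⟩
    have := tendsto_measure_iInter_atTop hnull
      (fun k m hkm ω (hω : (m : ℝ) + 1 ≤ ‖V ω‖) => by
        have : (k : ℝ) ≤ m := by exact_mod_cast hkm
        exact le_trans (by linarith) hω) ⟨0, measure_ne_top P' _⟩
    rwa [hempty, measure_empty] at this
  obtain ⟨k, hk⟩ := (hlim.eventually (gt_mem_nhds hη)).exists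
  refine ⟨k + 1, by positivity, ?_⟩
  have hclosed : IsClosed {x : E | (k : ℝ) + 1 ≤ ‖x‖} := isClosed_le continuous_const continuous_norm
  have hlimsup := ProbabilityMeasure.limsup_measure_closed_le_of_tendsto hY.tendsto hclosed
  simp only [ProbabilityMeasure.coe_mk] at hlimsup
  rw [Measure.map_apply_of_aemeasurable hV hclosed.measurableSet] at hlimsup
  have hev := eventually_lt_of_limsup_lt (lt_of_le_of_lt hlimsup hk)
  filter_upwards [hev] with T hT
  rwa [Measure.map_apply_of_aemeasurable (hY.forall_aemeasurable T) hclosed.measurableSet] at hT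

/-- The delta method. The function `f` need not be differentiable: it suffices that near `z₀` it
agrees with a differentiable function on the set `S` in which the random variables take their
values. -/
theorem tendstoInDistribution_of_hasFDerivAt [NormedSpace ℝ E] [SecondCountableTopology F]
    [L.IsCountablyGenerated]
    {Z : ι → Ω → E} {z₀ : E} {V : Ω' → E} {l : ι → ℝ} (hl : Tendsto l L atTop)
    (hY : TendstoInDistribution (fun T ω => l T • (Z T ω - z₀)) L V (fun _ => P) P')
    {f φ : E → F} {φ' : E →L[ℝ] F} (hφ : HasFDerivAt φ φ' z₀) {S : Set E}
    (hf : ∀ᶠ z in 𝓝 z₀, z ∈ S → f z = φ z) (hS : ∀ T, ∀ᵐ ω ∂P, Z T ω ∈ S)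
    (hmeas : ∀ T, AEMeasurable (fun ω => l T • (f (Z T ω) - φ z₀)) P) :
    TendstoInDistribution (fun T ω => l T • (f (Z T ω) - φ z₀)) L (fun ω => φ' (V ω))
      (fun _ => P) P' := by
  refine tendstoInDistribution_of_tendstoInMeasure_sub _ _ (hY.continuous_comp φ'.continuous) ?_
    hmeas
  rw [tendstoInMeasure_iff_norm]
  intro ε hε
  rw [ENNReal.tendsto_nhds_zero]
  intro η hη
  obtain ⟨K, hK, hKη⟩ := exists_eventually_measure_norm_ge_lt hY hη
  have hsmall := (hasFDerivAt_iff_isLittleO.1 hφ).def (show 0 < ε / (2 * K) by positivity)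
  obtain ⟨δ, hδ, hball⟩ := Metric.eventually_nhds_iff.1 (hf.and hsmall)
  filter_upwards [hKη, hl.eventually_gt_atTop 0, hl.eventually_gt_atTop (K / δ)] with T h1 h2 h3
  refine le_trans (measure_mono_ae ?_) h1.le
  filter_upwards [hS T] with ω hω hge
  by_contra hlt
  replace hlt : ‖l T • (Z T ω - z₀)‖ < K := not_le.1 hlt
  have hnorm : ‖l T • (Z T ω - z₀)‖ = l T * ‖Z T ω - z₀‖ := by
    rw [norm_smul, Real.norm_of_nonneg h2.le]
  have hdist : dist (Z T ω) z₀ < δ := by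
    rw [dist_eq_norm]
    have h4 : K < δ * l T := by rwa [div_lt_iff₀' hδ] at h3
    rw [hnorm] at hlt
    by_contra! h5
    nlinarith
  obtain ⟨h5, h6⟩ := hball hdist
  have h7 : ‖l T • (f (Z T ω) - φ z₀) - φ' (l T • (Z T ω - z₀)) - 0‖ < ε := by
    rw [sub_zero, h5 hω, map_smul, ← smul_sub, norm_smul, Real.norm_of_nonneg h2.le]
    calc l T * ‖φ (Z T ω) - φ z₀ - φ' (Z T ω - z₀)‖
        ≤ l T * (ε / (2 * K) * ‖Z T ω - z₀‖) := mul_le_mul_of_nonneg_left h6 h2.le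
      _ = ε / (2 * K) * ‖l T • (Z T ω - z₀)‖ := by rw [hnorm]; ring
      _ ≤ ε / (2 * K) * K := mul_le_mul_of_nonneg_left hlt.le (by positivity)
      _ = ε / 2 := by field_simp
      _ < ε := half_lt_self hε
  exact absurd hge (not_le.2 h7)

end DeltaMethod

/-! ### The limit of the coefficients -/

section Path

variable {n : ℕ} {t : ℝ}

/-- `L₁` as a function on the space of continuous paths. -/
def pathL1 (ht : 0 ≤ t) (x : C(Set.Icc (0 : ℝ) t, VecMat n)) : VecMat n × VecMat n × VecMat n :=
  L1 t (Set.IccExtend ht x)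

theorem continuous_pathL1 (ht : 0 ≤ t) : Continuous (pathL1 (n := n) ht) := by
  have hev : ∀ p, Continuous fun z : C(Set.Icc (0 : ℝ) t, VecMat n) × ℝ =>
      Set.IccExtend ht z.1 z.2 p := fun p => by
    have h : Continuous fun z : C(Set.Icc (0 : ℝ) t, VecMat n) × ℝ =>
        z.1 (Set.projIcc 0 t ht z.2) := by fun_prop
    exact (continuous_apply p).comp h
  have hev' : ∀ s p, Continuous fun x : C(Set.Icc (0 : ℝ) t, VecMat n) =>
      Set.IccExtend ht x s p := fun s p => (hev p).comp (continuous_id.prodMk continuous_const)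
  refine (continuous_pi fun p => ?_).prodMk ((continuous_pi fun p => ?_).prodMk
    (continuous_pi fun p => ?_))
  · refine intervalIntegral.continuous_parametric_intervalIntegral_of_continuous' ?_ 0 t
    exact (continuous_const.sub continuous_snd).mul ((hev p).add (hev p.swap))
  · refine intervalIntegral.continuous_parametric_intervalIntegral_of_continuous' ?_ 0 t
    exact (hev p).sub (hev p.swap)
  · exact ((hev' t p).add (hev' t p.swap)).sub (continuous_const.mul (hev' 0 p))

theorem pathL1_toPath (ht : 0 ≤ t) {x : ℝ → VecMat n} (hx : ContinuousOn x (Set.Icc 0 t)) :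
    pathL1 ht (toPath t x) = L1 t x := by
  have h : ∀ s ∈ Set.Icc 0 t, Set.IccExtend ht (toPath t x) s = x s := by
    intro s hs
    rw [Set.IccExtend_of_mem ht _ hs, toPath, dif_pos hx]
    rfl
  refine Prod.ext (funext fun p => ?_) (Prod.ext (funext fun p => ?_) (funext fun p => ?_))
  · refine intervalIntegral.integral_congr fun s hs => ?_
    rw [Set.uIcc_of_le ht] at hs
    simp only [h s hs]
  · refine intervalIntegral.integral_congr fun s hs => ?_
    rw [Set.uIcc_of_le ht] at hs
    simp only [h s hs]
  · simp only [pathL1, L1, h t (Set.right_mem_Icc.2 ht), h 0 (Set.left_mem_Icc.2 ht)]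

theorem L1_smul (a : ℝ) (x : ℝ → VecMat n) : L1 t (fun s => a • x s) = a • L1 t x := by
  refine Prod.ext (funext fun p => ?_) (Prod.ext (funext fun p => ?_) (funext fun p => ?_))
  · simp only [L1, Prod.smul_fst, Pi.smul_apply, smul_eq_mul]
    rw [← intervalIntegral.integral_const_mul]
    exact intervalIntegral.integral_congr fun s _ => by ring
  · simp only [L1, Prod.smul_snd, Prod.smul_fst, Pi.smul_apply, smul_eq_mul]
    rw [← intervalIntegral.integral_const_mul]
    exact intervalIntegral.integral_congr fun s _ => by ring
  · simp only [L1, Prod.smul_snd, Pi.smul_apply, smul_eq_mul]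
    ring

/-- An estimator that differs from an integrable function by a continuous one is integrable. -/
theorem intervalIntegrable_of_continuousOn_sub (ht : 0 ≤ t) {g k : ℝ → Matrix (Fin n) (Fin n) ℝ}
    (hk : ∀ i j, IntervalIntegrable (fun s => k s i j) volume 0 t)
    (hgk : ContinuousOn (fun s => Matrix.vec (g s - k s)) (Set.Icc 0 t)) (i j : Fin n) :
    IntervalIntegrable (fun s => g s i j) volume 0 t := by
  have h1 : ContinuousOn (fun s => g s i j - k s i j) (Set.uIcc 0 t) := by
    rw [Set.uIcc_of_le ht]
    exact (continuous_apply (j, i)).comp_continuousOn hgk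
  exact (h1.intervalIntegrable.add (hk i j)).congr fun s _ => by simp

theorem isSymm_coefC_reflect (ht : 0 ≤ t) {g : ℝ → Matrix (Fin n) (Fin n) ℝ}
    (hg : ∀ i j, IntervalIntegrable (fun s => g s i j) volume 0 t) :
    (coefC t (reflect g)).IsSymm := by
  ext i j
  rw [Matrix.transpose_apply, coefC_reflect_apply ht hg, coefC_reflect_apply ht hg]
  simp_rw [add_comm]

theorem isSymm_estD {g : ℝ → Matrix (Fin n) (Fin n) ℝ} {V : Matrix (Fin n) (Fin n) ℝ}
    (hV : V.IsSymm) (hg : (g 0).IsSymm) : (estD V t g).IsSymm := by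
  rw [Matrix.IsSymm, estD, Matrix.transpose_sub, Matrix.transpose_sub, Matrix.transpose_sub,
    Matrix.transpose_smul, Matrix.transpose_transpose, hV.eq, hg.eq]
  abel

theorem isSymm_covMatrix {Ω : Type u} [MeasurableSpace Ω] (P : Measure Ω) (V : Ω → Fin n → ℝ) :
    (covMatrix P V).IsSymm := by
  ext i j
  simp only [covMatrix, Matrix.transpose_apply, Matrix.of_apply]
  exact covariance_comm _ _

end Path

end Langevin

end

theorem theorem4 {n : ℕ}
    {Ω : Type u} [MeasurableSpace Ω] (P : Measure Ω) [IsProbabilityMeasure P]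
    {Ω' : Type v} [MeasurableSpace Ω'] (P' : Measure Ω') [IsProbabilityMeasure P']
    -- the Langevin equation, its noise and its stationary solution
    (Θ : Matrix (Fin n) (Fin n) ℝ) (G U : ℝ → Ω → Fin n → ℝ)
    (hGU : Langevin.LangevinSystem P Θ G U)
    (t : ℝ) (ht : 0 ≤ t)
    -- the cross-covariance and the coefficients of the Riccati equation
    (γ : ℝ → Matrix (Fin n) (Fin n) ℝ) (hγ : γ = Langevin.crossCov P U)
    (B C D : Matrix (Fin n) (Fin n) ℝ) (hB : B = Langevin.coefB t γ)
    (hC : C = Langevin.coefC t γ) (hD : D = Langevin.coefD P G U t)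
    -- estimators of `γ` on `[0,t]`, and the coefficients estimated from them
    (γhat : ℝ → ℝ → Ω → Matrix (Fin n) (Fin n) ℝ)
    (hmeas : ∀ T, ∀ s ∈ Set.Icc 0 t, ∀ i j, AEMeasurable (fun ω => γhat T s ω i j) P)
    (hcont : ∀ T, ∀ᵐ ω ∂P,
      ContinuousOn (fun s => Matrix.vec (γhat T s ω - γ s)) (Set.Icc 0 t))
    (Bhat Chat Dhat : ℝ → Ω → Matrix (Fin n) (Fin n) ℝ)
    (hBhat : ∀ T ω, Bhat T ω = Langevin.coefB t (fun s => γhat T s ω))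
    (hChat : ∀ T ω, Chat T ω = Langevin.coefC t (Langevin.reflect fun s => γhat T s ω))
    (hDhat : ∀ T ω, Dhat T ω =
      Langevin.estD (Langevin.covMatrix P (G t)) t (fun s => γhat T s ω))
    -- the limit process, the rate function and convergence in law in `C[0,t]`
    (X : ℝ → Ω' → Fin n × Fin n → ℝ)
    (hX : ∀ᵐ ω ∂P', ContinuousOn (fun s => X s ω) (Set.Icc 0 t))
    (l : ℝ → ℝ) (hl : Tendsto l atTop atTop)
    (hlaw : TendstoInDistribution
      (fun T ω => Langevin.toPath t fun s => l T • Matrix.vec (γhat T s ω - γ s)) atTop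
      (fun ω => Langevin.toPath t fun s => X s ω) (fun _ => P) P') :
    -- (1)
    TendstoInDistribution
      (fun T ω => l T •
        (Matrix.vec (Chat T ω - C), Matrix.vec (Bhat T ω - B), Matrix.vec (Dhat T ω - D)))
      atTop (fun ω => Langevin.L1 t fun s => X s ω) (fun _ => P) P' ∧
    -- (2)
    (C.PosDef → D.PosDef → (∀ T, ∀ᵐ ω ∂P, (γhat T 0 ω).IsSymm) →
      IsUnit (Langevin.kroneckerSum (B - C * Θ)ᵀ (B - C * Θ)ᵀ) ∧
      TendstoInDistribution
        (fun T ω => l T •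
          Matrix.vec (Langevin.careSolution (Bhat T ω) (Chat T ω) (Dhat T ω) - Θ))
        atTop (fun ω => Langevin.L2 Θ B C (Langevin.L1 t fun s => X s ω)) (fun _ => P) P' ∧
      -- `L₂` depends only on `Θ`, `t` and the cross-covariance of the noise
      ∀ {Ω₂ : Type u} [MeasurableSpace Ω₂] (P₂ : Measure Ω₂) [IsProbabilityMeasure P₂]
        (G₂ U₂ : ℝ → Ω₂ → Fin n → ℝ), Langevin.LangevinSystem P₂ Θ G₂ U₂ →
        (∀ a b, Langevin.crossMoment P₂ (G₂ a) (G₂ b) = Langevin.crossMoment P (G a) (G b)) →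
        Langevin.L2 Θ (Langevin.coefB t (Langevin.crossCov P₂ U₂))
          (Langevin.coefC t (Langevin.crossCov P₂ U₂)) = Langevin.L2 Θ B C) := by
  subst hγ hB hC hD
  have hIγ := hGU.intervalIntegrable_crossCov ht
  have hIγhat : ∀ T, ∀ᵐ ω ∂P, ∀ i j,
      IntervalIntegrable (fun s => γhat T s ω i j) volume 0 t := by
    intro T
    filter_upwards [hcont T] with ω hω
    exact Langevin.intervalIntegrable_of_continuousOn_sub ht hIγ hω
  have hDest : Langevin.coefD P G U t =
      Langevin.estD (Langevin.covMatrix P (G t)) t (Langevin.crossCov P U) := by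
    rw [Langevin.coefD, hGU.covMatrix_increment, Langevin.estD]
  have h1 : TendstoInDistribution (fun T ω => l T •
      (Matrix.vec (Chat T ω - Langevin.coefC t (Langevin.crossCov P U)),
        Matrix.vec (Bhat T ω - Langevin.coefB t (Langevin.crossCov P U)),
        Matrix.vec (Dhat T ω - Langevin.coefD P G U t)))
      atTop (fun ω => Langevin.L1 t fun s => X s ω) (fun _ => P) P' := by
    refine (hlaw.continuous_comp (Langevin.continuous_pathL1 ht)).congr (fun T => ?_) ?_
    · filter_upwards [hcont T, hIγhat T] with ω hω hI
      have hω' : ContinuousOn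
          (fun s => l T • Matrix.vec (γhat T s ω - Langevin.crossCov P U s)) (Set.Icc 0 t) :=
        hω.const_smul (l T)
      rw [Function.comp, Langevin.pathL1_toPath ht hω', Langevin.L1_smul,
        hBhat, hChat, hDhat, hDest, ← Langevin.coef_sub_coef_eq_L1 ht hI hIγ,
        hGU.reflect_crossCov]
    · filter_upwards [hX] with ω hω
      exact Langevin.pathL1_toPath ht hω
  refine ⟨h1, fun hCpos hDpos hsymm => ?_⟩
  have hsol := hGU.isPSDSolution ht
  refine ⟨Langevin.isUnit_kroneckerSum (hsol.lyapunovStable hCpos hDpos), ?_, ?_⟩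
  · obtain ⟨φ, hφ, hφ0, hφe⟩ := Langevin.exists_hasFDerivAt_careVec hsol hCpos hDpos
    have hmeas' : ∀ T, AEMeasurable (fun ω => l T • (Langevin.careVec
        (Matrix.vec (Chat T ω), Matrix.vec (Bhat T ω), Matrix.vec (Dhat T ω)) - Matrix.vec Θ))
        P := by
      intro T
      -- Where `l T = 0`, the convergence in law carries no information on the estimators.
      by_cases hlT : l T = 0
      · simp [hlT]
      have hZ : AEMeasurable (fun ω =>
          (Matrix.vec (Chat T ω), Matrix.vec (Bhat T ω), Matrix.vec (Dhat T ω))) P := by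
        have h2 := ((h1.forall_aemeasurable T).const_smul (l T)⁻¹).add_const
          (Matrix.vec (Langevin.coefC t (Langevin.crossCov P U)),
            Matrix.vec (Langevin.coefB t (Langevin.crossCov P U)),
            Matrix.vec (Langevin.coefD P G U t))
        refine h2.congr (ae_of_all _ fun ω => ?_)
        simp only [Pi.smul_apply, smul_smul, inv_mul_cancel₀ hlT, one_smul, Matrix.vec_sub,
          Prod.mk_add_mk, sub_add_cancel]
      exact ((Langevin.measurable_careVec.comp_aemeasurable hZ).sub_const _).const_smul (l T)
    rw [← hφ0] at hmeas'
    have h3 := Langevin.tendstoInDistribution_of_hasFDerivAt (f := Langevin.careVec)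
      (S := {z | (Langevin.unvec z.1).IsSymm ∧ (Langevin.unvec z.2.2).IsSymm}) hl h1 hφ
      (hφe.mono fun z hz hzS => hz hzS.1 hzS.2) (fun T => ?_) hmeas'
    · rw [hφ0] at h3
      exact h3
    · filter_upwards [hIγhat T, hsymm T] with ω hI hs
      rw [hChat, hDhat]
      exact ⟨Langevin.isSymm_coefC_reflect ht hI,
        Langevin.isSymm_estD (g := fun s => γhat T s ω) (Langevin.isSymm_covMatrix P (G t)) hs⟩
  · intro Ω₂ _ P₂ _ G₂ U₂ hS₂ hcross
    rw [hGU.crossCov_eq_of_crossMoment_eq hS₂ hcross]
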